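/- Fix $d\ge 1$. Call $\boldsymbol\rho=(\rho_1,\dots,\rho_m)$ a contraction vector if $0<\rho_j<1$ for all $j$ and $\sum_j\rho_j^d<1$. Let $\mathcal D(\boldsymbol\rho)$ be the set of all nonempty compact $E\subset\mathbb R^d$ such that $E=\bigcup_{j=1}^m\phi_j(E)$ for some similarities $\phi_j$ of $\mathbb R^d$ with ratios $\rho_j$, the sets $\phi_1(E),\dots,\phi_m(E)$ being pairwise disjoint. Write $\mathcal D(\boldsymbol\rho)\sim\mathcal D(\boldsymbol\tau)$ if there are $E\in\mathcal D(\boldsymbol\rho)$, $F\in\mathcal D(\boldsymbol\tau)$, a bijection $f:E\to F$ and a constant $C>0$ with $C^{-1}|x-y|\le|f(x)-f(y)|\le C|x-y|$ for all $x,y\in E$. A pseudo-basis of $\boldsymbol\rho$ is a tuple $\boldsymbol\lambda=(\lambda_1,\dots,\lambda_s)$ of positive reals such that the multiplicative group $\langle\rho_1,\dots,\rho_m\rangle$ is contained in $\langle\lambda_1,\dots,\lambda_s\rangle$ and has rank $s$. Then $x\mapsto\boldsymbol\lambda^x=\prod_i\lambda_i^{x_i}$ is an isomorphism $\mathbb Z^s\to\langle\boldsymbol\lambda\rangle$;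 its inverse is denoted $\log_{\boldsymbol\lambda}$. For $X=(X_1,\dots,X_m)$ with $X_j\in\mathbb Z^s$ lying in a common open half-space bounded by a hyperplane through $0$, put $\mathbf C_X=\{\sum_j c_jX_j: c_j\ge 0\}\subset\mathbb R^s$ and $\mathcal J_X=\{\sum_j a_jX_j: a_j\in\mathbb Z_{\ge0}\}$. For $z\in\mathcal J_X$ let $\mathbf m_X(z)$ be the number of finite words $i_1\dots i_k$ ($k\ge0$) over $\{1,\dots,m\}$ with $X_{i_1}+\dots+X_{i_k}=z$; for $x\in\mathbf C_X$ let $\mathbf m_X(x)$ be the minimum of $\mathbf m_X(z)$ over the points $z\in\mathcal J_X$ nearest to $x$ in Euclidean distance. For a unit vector $\theta\in\mathbf C_X$ the directional growth function is $$\gamma_X(\theta)=\lim_{k\to\infty}\frac{\log\mathbf m_X(k\theta)}{k}\qquad(k\in\mathbb N).$$ **Theorem.** Let $\boldsymbol\rho=(\rho_1,\dots,\rho_m)$ and $\boldsymbol\tau=(\tau_1,\dots,\tau_n)$ be contraction vectors with $\mathcal D(\boldsymbol\rho)\sim\mathcal D(\boldsymbol\tau)$, let $\boldsymbol\lambda=(\lambda_1,\dots,\lambda_s)$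 be a common pseudo-basis of $\boldsymbol\rho$ and $\boldsymbol\tau$, and put $X_j=\log_{\boldsymbol\lambda}\rho_j$ $(1\le j\le m)$ and $Y_k=\log_{\boldsymbol\lambda}\tau_k$ $(1\le k\le n)$; both families lie in the open half-space $\{x:\sum_i x_i\log\lambda_i<0\}$. Then (i) $\mathbf C_X=\mathbf C_Y$; (ii) for every unit vector $\theta\in\mathbf C_X$, the limits defining $\gamma_X(\theta)$ and $\gamma_Y(\theta)$ exist, and $\gamma_X(\theta)=\gamma_Y(\theta)$. -/

import Mathlib

open Filter Topology

namespace FrobeniusLipschitz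

noncomputable section

/-! ### Dust-like self-similar sets and Lipschitz equivalence -/

/-- `ρ = (ρ₁, …, ρ_m)` is a contraction vector (for the ambient space `ℝᵈ`):
all `ρ j` lie in `(0,1)` and `∑ ρ_j ^ d < 1`. -/
def IsContractionVector (d : ℕ) {m : ℕ} (ρ : Fin m → ℝ) : Prop :=
  (∀ j, 0 < ρ j ∧ ρ j < 1) ∧ ∑ j, ρ j ^ d < 1

/-- `φ` is a similarity of `ℝᵈ` with ratio `r`. -/
def IsSimilarity {d : ℕ} (r : ℝ)
    (φ : EuclideanSpace ℝ (Fin d) → EuclideanSpace ℝ (Fin d)) : Prop :=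
  ∀ x y, dist (φ x) (φ y) = r * dist x y

/-- `E` is the attractor of the iterated function system `φ`: a nonempty compact set with
`E = ⋃ j, φ_j(E)`. -/
def IsAttractor {d m : ℕ}
    (φ : Fin m → EuclideanSpace ℝ (Fin d) → EuclideanSpace ℝ (Fin d))
    (E : Set (EuclideanSpace ℝ (Fin d))) : Prop :=
  E.Nonempty ∧ IsCompact E ∧ E = ⋃ j, φ j '' E

/-- `𝒟(ρ)`: the set of all dust-like self-similar sets in `ℝᵈ` with contraction ratios
`ρ₁, …, ρ_m`. Dust-like means that the pieces `φ_j(E)` are pairwise disjoint. -/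
def dustLike (d : ℕ) {m : ℕ} (ρ : Fin m → ℝ) : Set (Set (EuclideanSpace ℝ (Fin d))) :=
  {E | ∃ φ : Fin m → EuclideanSpace ℝ (Fin d) → EuclideanSpace ℝ (Fin d),
    (∀ j, IsSimilarity (ρ j) (φ j)) ∧ IsAttractor φ E ∧
    Pairwise fun i j => Disjoint (φ i '' E) (φ j '' E)}

/-- Lipschitz equivalence `E ∼ F` of subsets of `ℝᵈ`. -/
def LipschitzEquivalent {d : ℕ} (E F : Set (EuclideanSpace ℝ (Fin d))) : Prop :=
  ∃ f : E → F, Function.Bijective f ∧ ∃ C : ℝ, 0 < C ∧ ∀ x y : E,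
    C⁻¹ * dist x y ≤ dist (f x) (f y) ∧ dist (f x) (f y) ≤ C * dist x y

/-- `𝒟(ρ) ∼ 𝒟(τ)`: some `E ∈ 𝒟(ρ)` and some `F ∈ 𝒟(τ)` are Lipschitz equivalent. -/
def DustLikeEquivalent (d : ℕ) {m n : ℕ} (ρ : Fin m → ℝ) (τ : Fin n → ℝ) : Prop :=
  ∃ E ∈ dustLike d ρ, ∃ F ∈ dustLike d τ, LipschitzEquivalent E F

/-! ### Pseudo-bases and logarithms -/

/-- The multiplicative group `⟨a₁, …, a_m⟩` generated by the (nonzero) reals `a_j`. -/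
def mulGroup {m : ℕ} (a : Fin m → ℝ) : Subgroup ℝˣ :=
  Subgroup.closure {u : ℝˣ | ∃ j, (u : ℝ) = a j}

/-- The rank of the group `⟨a₁, …, a_m⟩`, as a `ℤ`-module. -/
def mulRank {m : ℕ} (a : Fin m → ℝ) : ℕ :=
  Module.finrank ℤ (Additive (mulGroup a))

/-- `lam = (λ₁, …, λ_s)` is a pseudo-basis of `ρ`: the `λ_i` are positive,
`⟨ρ⟩ ⊆ ⟨λ⟩`, and `⟨ρ⟩` has rank `s`. -/
def IsPseudoBasis {m s : ℕ} (ρ : Fin m → ℝ) (lam : Fin s → ℝ) : Prop :=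
  (∀ i, 0 < lam i) ∧ mulGroup ρ ≤ mulGroup lam ∧ mulRank ρ = s

/-- `λ ^ x = ∏ λ_i ^ x_i` for `x ∈ ℤˢ`. -/
def expBasis {s : ℕ} (lam : Fin s → ℝ) (x : Fin s → ℤ) : ℝ :=
  ∏ i, lam i ^ x i

/-- `log_λ`, the inverse of `x ↦ λ ^ x`. Only its values on `⟨λ⟩` matter, and when `λ` is a
pseudo-basis these are uniquely determined (see `logBasis_eq_iff`). -/
def logBasis {s : ℕ} (lam : Fin s → ℝ) : ℝ → (Fin s → ℤ) :=
  Function.invFun (expBasis lam)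

/-! ### The higher-dimensional Frobenius problem with defining data `X₁, …, X_m ∈ ℤˢ` -/

/-- The inclusion `ℤˢ ⊆ ℝˢ`. -/
def toEuclid {s : ℕ} (z : Fin s → ℤ) : EuclideanSpace ℝ (Fin s) :=
  WithLp.toLp 2 fun i => (z i : ℝ)

/-- The cone `C_X = ℝ⁺ X₁ + ⋯ + ℝ⁺ X_m`, where `ℝ⁺` is the set of nonnegative reals. -/
def cone {m s : ℕ} (X : Fin m → Fin s → ℤ) : Set (EuclideanSpace ℝ (Fin s)) :=
  {v | ∃ c : Fin m → ℝ, (∀ j, 0 ≤ c j) ∧ v = ∑ j, c j • toEuclid (X j)}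

/-- The position `κ(w) = X_{i₁} + ⋯ + X_{i_k}` reached along the word `w = i₁ … i_k`. -/
def position {m s : ℕ} (X : Fin m → Fin s → ℤ) (w : List (Fin m)) : Fin s → ℤ :=
  (w.map X).sum

/-- The semigroup `𝒥 = ℕ X₁ + ⋯ + ℕ X_m`. -/
def semigroup {m s : ℕ} (X : Fin m → Fin s → ℤ) : Set (Fin s → ℤ) :=
  {z | ∃ a : Fin m → ℕ, z = ∑ j, a j • X j}

/-- The multiplicity of a lattice point `z`: the number of words `w` with `κ(w) = z`
(finitely many when the `X_j` lie in an open half-space). -/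
def latticeMultiplicity {m s : ℕ} (X : Fin m → Fin s → ℤ) (z : Fin s → ℤ) : ℕ :=
  {w : List (Fin m) | position X w = z}.ncard

/-- The multiplicity of a point `x ∈ ℝˢ`: the smallest multiplicity among the points of `𝒥`
nearest to `x` in the Euclidean distance. -/
def multiplicity {m s : ℕ} (X : Fin m → Fin s → ℤ) (x : EuclideanSpace ℝ (Fin s)) : ℕ :=
  sInf (latticeMultiplicity X '' {z | z ∈ semigroup X ∧
    dist x (toEuclid z) = Metric.infDist x (toEuclid '' semigroup X)})

/-- The sequence `k ↦ log m(kθ) / k`. -/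
def growthSeq {m s : ℕ} (X : Fin m → Fin s → ℤ) (θ : EuclideanSpace ℝ (Fin s)) (k : ℕ) : ℝ :=
  Real.log (multiplicity X ((k : ℝ) • θ)) / k

/-- The directional growth function `γ_X(θ) = lim_{k → ∞} log m(kθ) / k`. -/
def directionalGrowth {m s : ℕ} (X : Fin m → Fin s → ℤ) (θ : EuclideanSpace ℝ (Fin s)) : ℝ :=
  limUnder atTop (growthSeq X θ)

/-! ### `log_λ` is well defined when `λ` is a pseudo-basis -/

/-- `x ↦ λ ^ x` as a `ℤ`-linear map into the units of `ℝ`. -/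
def expHom {s : ℕ} (u : Fin s → ℝˣ) : (Fin s → ℤ) →ₗ[ℤ] Additive ℝˣ :=
  Fintype.linearCombination ℤ (fun i => Additive.ofMul (u i))

lemma coe_expHom {s : ℕ} (u : Fin s → ℝˣ) (x : Fin s → ℤ) :
    (((expHom u x).toMul : ℝˣ) : ℝ) = expBasis (fun i => (u i : ℝ)) x := by
  simp [expHom, expBasis, Fintype.linearCombination_apply, toMul_sum]

lemma mem_mulGroup_iff {s : ℕ} (u : Fin s → ℝˣ) (v : ℝˣ) :
    v ∈ mulGroup (fun i => (u i : ℝ)) ↔ ∃ x, expBasis (fun i => (u i : ℝ)) x = v := by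
  constructor
  · intro hv
    have : mulGroup (fun i => (u i : ℝ)) ≤
        (AddSubgroup.toSubgroup' (LinearMap.range (expHom u)).toAddSubgroup) := by
      refine (Subgroup.closure_le _).2 ?_
      rintro w ⟨j, hj⟩
      refine ⟨Pi.single j 1, ?_⟩
      have : w = u j := Units.ext hj
      simp [expHom, this]
      rfl
    obtain ⟨x, hx⟩ := this hv
    refine ⟨x, ?_⟩
    rw [← coe_expHom, hx]
    rfl
  · rintro ⟨x, hx⟩
    have : v = ∏ i, u i ^ x i := by
      apply Units.ext
      rw [← hx]
      simp [expBasis]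
    rw [this]
    exact Subgroup.prod_mem _ fun i _ => Subgroup.zpow_mem _
      (Subgroup.subset_closure (show u i ∈ {w : ℝˣ | ∃ j, (w : ℝ) = u j} from ⟨i, rfl⟩)) _

lemma expBasis_injective {m s : ℕ} {ρ : Fin m → ℝ} {lam : Fin s → ℝ}
    (h : IsPseudoBasis ρ lam) : Function.Injective (expBasis lam) := by
  obtain ⟨hpos, hle, hrank⟩ := h
  obtain ⟨u, rfl⟩ : ∃ u : Fin s → ℝˣ, (fun i => (u i : ℝ)) = lam :=
    ⟨fun i => Units.mk0 (lam i) (hpos i).ne', rfl⟩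
  have hinj : Function.Injective (expHom u) := by
    rw [← LinearMap.ker_eq_bot, ← Submodule.finrank_eq_zero (R := ℤ)]
    have h1 := Submodule.finrank_quotient_add_finrank (LinearMap.ker (expHom u))
    rw [(expHom u).quotKerEquivRange.finrank_eq] at h1
    rw [Module.finrank_fin_fun] at h1
    have h2 : s ≤ Module.finrank ℤ (LinearMap.range (expHom u)) := by
      refine hrank.symm.le.trans ?_
      have hmem : ∀ g : Additive (mulGroup ρ),
          (MonoidHom.toAdditive (mulGroup ρ).subtype).toIntLinearMap g ∈
            LinearMap.range (expHom u) := by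
        intro g
        obtain ⟨x, hx⟩ := (mem_mulGroup_iff u _).1 (hle g.toMul.2)
        refine ⟨x, ?_⟩
        apply Additive.toMul.injective
        apply Units.ext
        rw [coe_expHom, hx]
        rfl
      refine LinearMap.finrank_le_finrank_of_injective
        (f := LinearMap.codRestrict _
          (MonoidHom.toAdditive (mulGroup ρ).subtype).toIntLinearMap hmem) ?_
      intro a b hab
      have := congrArg Subtype.val hab
      exact Subtype.val_injective this
    omega
  intro x y hxy
  apply hinj
  apply Additive.toMul.injective
  apply Units.ext
  rw [coe_expHom, coe_expHom, hxy]

/-- For a pseudo-basis `λ` of `ρ`, `log_λ ρ_j` is the unique `x ∈ ℤˢ` with `λ ^ x = ρ_j`. -/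
lemma logBasis_eq_iff {m s : ℕ} {ρ : Fin m → ℝ} {lam : Fin s → ℝ}
    (h : IsPseudoBasis ρ lam) (hρ : ∀ j, 0 < ρ j) (j : Fin m) (x : Fin s → ℤ) :
    logBasis lam (ρ j) = x ↔ expBasis lam x = ρ j := by
  have hinj := expBasis_injective h
  obtain ⟨hpos, hle, -⟩ := h
  obtain ⟨u, rfl⟩ : ∃ u : Fin s → ℝˣ, (fun i => (u i : ℝ)) = lam :=
    ⟨fun i => Units.mk0 (lam i) (hpos i).ne', rfl⟩
  have hmem : Units.mk0 (ρ j) (hρ j).ne' ∈ mulGroup ρ := Subgroup.subset_closure ⟨j, rfl⟩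
  have hex := (mem_mulGroup_iff u _).1 (hle hmem)
  have hinv := Function.invFun_eq hex
  constructor
  · rintro rfl
    exact hinv
  · intro hx
    exact hinj (hinv.trans hx.symm)

end

end FrobeniusLipschitz

open FrobeniusLipschitz

/-! A bi-Lipschitz map puts the cylinders `A w` of `E` and `B v` of `F` into one metric space. Let
`v` be the longest word with `A w ⊆ B v`. Then `τ_v` is comparable to `ρ_w`, and `A w` is a union of
cylinders `B (v ++ b)` with `b` of a fixed length `M`. Choose `δ` with `∑ τ_j ^ δ = 1`. The
self-similar measure with weights `τ_j ^ δ` gives `A w` the mass `τ_v ^ δ * β w`, with `β w` in a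
finite set. Comparability and additivity force `∑ ρ_j ^ δ = 1`, so the density `q w`, the mass of `A
w` divided by `ρ_w ^ δ`, is a bounded positive martingale on the tree of words.

The ratios `q (w ++ u) / q w` with `u` of bounded length take finitely many values. Hence `q` is
constant on a subtree of any prescribed height, rooted where `q` is nearly maximal
(`exists_martingale_const`). There `ρ_u` equals the ratio of a word over the second alphabet up to a
factor from a finite set that does not depend on the height (`exists_rigid_coding`). The coding
identifies two words only if one is a prefix of the other. Words with the same position form an
antichain, so in logarithmic coordinates the number of words over `z` is at most the sum of
`latticeMultiplicity Y (z + e)` over finitely many `e` (`exists_dominated`). The roles of `X` and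
`Y` can be exchanged.

The rest is combinatorics in the lattice. Dickson's lemma turns domination into inclusion of cones
(`cone_subset_of_dominated`), and makes multiplicities at bounded distance polynomially comparable
(`exists_latticeMultiplicity_add_le`). Together with concatenation of words this makes `log m(kθ)`
almost superadditive, so its growth rate exists; polynomial factors and bounded translations do not
affect the rate. If there is only one contraction, the sets are points and the lattice has rank at
most one; this case is treated directly. -/

namespace FrobeniusLipschitz

/-! ### Weights of words -/

/-- The product `p_{i₁} ⋯ p_{i_k}` of the weights along a word `i₁ … i_k`. -/
noncomputable def wordProd {m : ℕ} (p : Fin m → ℝ) (w : List (Fin m)) : ℝ := (w.map p).prod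

section wordProd

variable {m : ℕ} {p : Fin m → ℝ}

@[simp] lemma wordProd_nil : wordProd p [] = 1 := by simp [wordProd]

@[simp] lemma wordProd_cons (j : Fin m) (w : List (Fin m)) :
    wordProd p (j :: w) = p j * wordProd p w := by simp [wordProd]

@[simp] lemma wordProd_append (u w : List (Fin m)) :
    wordProd p (u ++ w) = wordProd p u * wordProd p w := by simp [wordProd]

lemma wordProd_pos (hp : ∀ j, 0 < p j) (w : List (Fin m)) : 0 < wordProd p w := by
  induction w with
  | nil => simp
  | cons j w ih => simpa using mul_pos (hp j) ih

lemma wordProd_rpow (hp : ∀ j, 0 < p j) (δ : ℝ) (w : List (Fin m)) :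
    wordProd (fun j => p j ^ δ) w = wordProd p w ^ δ := by
  induction w with
  | nil => simp
  | cons j w ih =>
    rw [wordProd_cons, wordProd_cons, ih, Real.mul_rpow (hp j).le (wordProd_pos hp w).le]

lemma wordProd_le_one (hp : ∀ j, 0 < p j ∧ p j < 1) (w : List (Fin m)) : wordProd p w ≤ 1 := by
  induction w with
  | nil => simp
  | cons j w ih =>
    rw [wordProd_cons]
    exact mul_le_one₀ (hp j).2.le (wordProd_pos (fun j => (hp j).1) w).le ih

lemma exists_wordProd_le_pow (hp : ∀ j, 0 < p j ∧ p j < 1) :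
    ∃ t : ℝ, 0 < t ∧ t < 1 ∧ ∀ w, wordProd p w ≤ t ^ w.length := by
  obtain ⟨t, ht0, ht1, ht⟩ : ∃ t : ℝ, 0 < t ∧ t < 1 ∧ ∀ j, p j ≤ t := by
    rcases isEmpty_or_nonempty (Fin m) with h | h
    · exact ⟨1 / 2, by norm_num, by norm_num, fun j => h.elim j⟩
    · obtain ⟨i, hi⟩ := Finite.exists_max p
      exact ⟨p i, (hp i).1, (hp i).2, hi⟩
  refine ⟨t, ht0, ht1, fun w => ?_⟩
  induction w with
  | nil => simp
  | cons j w ih =>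
    rw [wordProd_cons, List.length_cons, pow_succ']
    exact mul_le_mul (ht j) ih (wordProd_pos (fun j => (hp j).1) w).le ht0.le

lemma exists_wordProd_lt (hp : ∀ j, 0 < p j ∧ p j < 1) {ε : ℝ} (hε : 0 < ε) :
    ∃ N : ℕ, ∀ w : List (Fin m), N ≤ w.length → wordProd p w < ε := by
  obtain ⟨t, ht0, ht1, ht⟩ := exists_wordProd_le_pow hp
  obtain ⟨N, hN⟩ := exists_pow_lt_of_lt_one hε ht1
  exact ⟨N, fun w hw => ((ht w).trans (pow_le_pow_of_le_one ht0.le ht1.le hw)).trans_lt hN⟩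

end wordProd

/-! ### Cylinder systems -/

/-- A system of cylinders `A w` in a metric space, of size comparable to `ρ_w`, such that the
children of each cylinder form a partition of it into well separated pieces. -/
structure IsCylinderSystem {E : Type*} [MetricSpace E] {m : ℕ} (ρ : Fin m → ℝ)
    (A : List (Fin m) → Set E) : Prop where
  ratio : ∀ j, 0 < ρ j ∧ ρ j < 1
  nil : A [] = Set.univ
  split : ∀ w, A w = ⋃ j, A (w ++ [j])
  nonempty : ∀ w, (A w).Nonempty
  exists_dist_le : ∃ D > 0, ∀ w, ∀ x ∈ A w, ∀ y ∈ A w, dist x y ≤ D * wordProd ρ w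
  exists_le_dist : ∃ g > 0, ∀ w i j, i ≠ j → ∀ x ∈ A (w ++ [i]), ∀ y ∈ A (w ++ [j]),
    g * wordProd ρ w ≤ dist x y

/-- `v` is the longest word such that the cylinder `B v` contains `A w`. -/
def IsHull {E : Type*} {m n : ℕ} (A : List (Fin m) → Set E) (B : List (Fin n) → Set E)
    (w : List (Fin m)) (v : List (Fin n)) : Prop :=
  A w ⊆ B v ∧ ∀ j, ¬ A w ⊆ B (v ++ [j])

namespace IsCylinderSystem

variable {E : Type*} [MetricSpace E] {m n : ℕ} {ρ : Fin m → ℝ} {τ : Fin n → ℝ}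
  {A : List (Fin m) → Set E} {B : List (Fin n) → Set E}

lemma ratio_pos (hA : IsCylinderSystem ρ A) (j : Fin m) : 0 < ρ j := (hA.ratio j).1

lemma wordProd_pos (hA : IsCylinderSystem ρ A) (w : List (Fin m)) : 0 < wordProd ρ w :=
  FrobeniusLipschitz.wordProd_pos hA.ratio_pos w

lemma append_subset (hA : IsCylinderSystem ρ A) (w u : List (Fin m)) : A (w ++ u) ⊆ A w := by
  induction u using List.reverseRecOn with
  | nil => simp
  | append_singleton u j ih =>
    refine Set.Subset.trans ?_ ih
    rw [hA.split (w ++ u), ← List.append_assoc]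
    exact Set.subset_iUnion (fun j => A (w ++ u ++ [j])) j

lemma exists_mem_append (hA : IsCylinderSystem ρ A) {w : List (Fin m)} {x : E} (hx : x ∈ A w)
    (N : ℕ) : ∃ u : List (Fin m), u.length = N ∧ x ∈ A (w ++ u) := by
  induction N with
  | zero => exact ⟨[], rfl, by simpa using hx⟩
  | succ N ih =>
    obtain ⟨u, hu, hxu⟩ := ih
    rw [hA.split, Set.mem_iUnion] at hxu
    obtain ⟨j, hj⟩ := hxu
    exact ⟨u ++ [j], by simp [hu], by rwa [← List.append_assoc]⟩

lemma disjoint_children (hA : IsCylinderSystem ρ A) (w : List (Fin m)) {i j : Fin m}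
    (hij : i ≠ j) : Disjoint (A (w ++ [i])) (A (w ++ [j])) := by
  obtain ⟨g, hg, h⟩ := hA.exists_le_dist
  rw [Set.disjoint_left]
  intro x hx hy
  have h1 := h w i j hij x hx x hy
  rw [dist_self] at h1
  exact absurd h1 (not_le.2 (mul_pos hg (hA.wordProd_pos w)))

lemma prefix_or_prefix_of_mem_append (hA : IsCylinderSystem ρ A) {x : E} (v w w' : List (Fin m))
    (hw : x ∈ A (v ++ w)) (hw' : x ∈ A (v ++ w')) : w <+: w' ∨ w' <+: w := by
  induction w generalizing v w' with
  | nil => exact Or.inl List.nil_prefix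
  | cons i w ih =>
    cases w' with
    | nil => exact Or.inr List.nil_prefix
    | cons j w' =>
      have e1 : v ++ i :: w = (v ++ [i]) ++ w := by simp
      have e2 : v ++ j :: w' = (v ++ [j]) ++ w' := by simp
      rw [e1] at hw
      rw [e2] at hw'
      by_cases hij : i = j
      · subst hij
        simpa using ih _ _ hw hw'
      · exact ((Set.disjoint_left.1 (hA.disjoint_children v hij)) (hA.append_subset _ _ hw)
          (hA.append_subset _ _ hw')).elim

lemma prefix_or_prefix (hA : IsCylinderSystem ρ A) {x : E} {w w' : List (Fin m)}
    (hw : x ∈ A w) (hw' : x ∈ A w') : w <+: w' ∨ w' <+: w :=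
  hA.prefix_or_prefix_of_mem_append [] w w' hw hw'

/-- A point outside `A (w ++ [i])` lies in a sibling or already outside `A w`, and the ratio of the
parent is the larger one. -/
lemma exists_le_dist_compl (hA : IsCylinderSystem ρ A) :
    ∃ g > 0, ∀ w, ∀ x ∈ A w, ∀ y ∉ A w, g * wordProd ρ w ≤ dist x y := by
  obtain ⟨g, hg, h⟩ := hA.exists_le_dist
  refine ⟨g, hg, fun w => ?_⟩
  induction w using List.reverseRecOn with
  | nil => intro x _ y hy; rw [hA.nil] at hy; exact (hy trivial).elim
  | append_singleton w i ih =>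
    intro x hx y hy
    have hle : g * wordProd ρ (w ++ [i]) ≤ g * wordProd ρ w := by
      rw [wordProd_append]
      refine mul_le_mul_of_nonneg_left ?_ hg.le
      exact mul_le_of_le_one_right (hA.wordProd_pos w).le (wordProd_le_one hA.ratio _)
    refine hle.trans ?_
    by_cases hyw : y ∈ A w
    · rw [hA.split, Set.mem_iUnion] at hyw
      obtain ⟨j, hj⟩ := hyw
      refine h w i j ?_ x hx y hj
      rintro rfl
      exact hy hj
    · exact ih x (hA.append_subset _ _ hx) y hyw

lemma exists_mem_le_dist [Nontrivial (Fin m)] (hA : IsCylinderSystem ρ A) :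
    ∃ g > 0, ∀ w, ∃ x ∈ A w, ∃ y ∈ A w, g * wordProd ρ w ≤ dist x y := by
  obtain ⟨g, hg, h⟩ := hA.exists_le_dist
  obtain ⟨i, j, hij⟩ := exists_pair_ne (Fin m)
  refine ⟨g, hg, fun w => ?_⟩
  obtain ⟨x, hx⟩ := hA.nonempty (w ++ [i])
  obtain ⟨y, hy⟩ := hA.nonempty (w ++ [j])
  exact ⟨x, hA.append_subset _ _ hx, y, hA.append_subset _ _ hy, h w i j hij x hx y hy⟩

lemma exists_mul_le_of_subset [Nontrivial (Fin m)] (hA : IsCylinderSystem ρ A)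
    (hB : IsCylinderSystem τ B) :
    ∃ c > 0, ∀ w v, A w ⊆ B v → c * wordProd ρ w ≤ wordProd τ v := by
  obtain ⟨g, hg, h⟩ := hA.exists_mem_le_dist
  obtain ⟨D, hD, h'⟩ := hB.exists_dist_le
  refine ⟨g / D, div_pos hg hD, fun w v hwv => ?_⟩
  obtain ⟨x, hx, y, hy, hxy⟩ := h w
  have h1 := hxy.trans (h' v x (hwv hx) y (hwv hy))
  rw [div_mul_eq_mul_div, div_le_iff₀ hD]
  linarith

/-- `A w` has diameter at least a constant times `ρ_w`, so it cannot lie in cylinders `B v` with `v`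
arbitrarily long. -/
lemma exists_isHull [Nontrivial (Fin m)] (hA : IsCylinderSystem ρ A)
    (hB : IsCylinderSystem τ B) (w : List (Fin m)) : ∃ v, IsHull A B w v := by
  by_contra! hcon
  obtain ⟨c, hc, h⟩ := hA.exists_mul_le_of_subset hB
  have key : ∀ N : ℕ, ∃ v : List (Fin n), v.length = N ∧ A w ⊆ B v := by
    intro N
    induction N with
    | zero => exact ⟨[], rfl, by simp [hB.nil]⟩
    | succ N ih =>
      obtain ⟨v, hv, hwv⟩ := ih
      have := hcon v
      simp only [IsHull, not_and, not_forall, not_not] at this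
      obtain ⟨j, hj⟩ := this hwv
      exact ⟨v ++ [j], by simp [hv], hj⟩
  obtain ⟨N, hN⟩ := exists_wordProd_lt hB.ratio (mul_pos hc (hA.wordProd_pos w))
  obtain ⟨v, hv, hwv⟩ := key N
  exact absurd (h w v hwv) (not_le.2 (hN v hv.ge))

/-- By maximality of `v`, the set `A w` meets two different children of `B v`; these are separated
at the scale `τ_v`. -/
lemma exists_le_mul_of_isHull (hA : IsCylinderSystem ρ A) (hB : IsCylinderSystem τ B) :
    ∃ C > 0, ∀ w v, IsHull A B w v → wordProd τ v ≤ C * wordProd ρ w := by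
  obtain ⟨g, hg, h⟩ := hB.exists_le_dist
  obtain ⟨D, hD, h'⟩ := hA.exists_dist_le
  refine ⟨D / g, div_pos hD hg, fun w v hwv => ?_⟩
  obtain ⟨x, hx⟩ := hA.nonempty w
  have hxv := hwv.1 hx
  rw [hB.split, Set.mem_iUnion] at hxv
  obtain ⟨i, hi⟩ := hxv
  obtain ⟨y, hy, hyi⟩ := Set.not_subset.1 (hwv.2 i)
  have hyv := hwv.1 hy
  rw [hB.split, Set.mem_iUnion] at hyv
  obtain ⟨j, hj⟩ := hyv
  have hij : i ≠ j := by rintro rfl; exact hyi hj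
  have h1 := (h v i j hij x hi y hj).trans (h' w x hx y hy)
  rw [div_mul_eq_mul_div, le_div_iff₀ hg]
  linarith

/-- At a fixed depth below the hull, the cylinders of `B` are smaller than the gap between `A w` and
its complement, so none of them straddles the boundary. -/
lemma exists_saturated (hA : IsCylinderSystem ρ A) (hB : IsCylinderSystem τ B) :
    ∃ M : ℕ, ∀ w v, IsHull A B w v → ∀ b : List (Fin n), b.length = M →
      (B (v ++ b) ∩ A w).Nonempty → B (v ++ b) ⊆ A w := by
  obtain ⟨C, hC, h⟩ := hA.exists_le_mul_of_isHull hB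
  obtain ⟨D, hD, h'⟩ := hB.exists_dist_le
  obtain ⟨g, hg, h''⟩ := hA.exists_le_dist_compl
  obtain ⟨M, hM⟩ := exists_wordProd_lt hB.ratio (div_pos hg (mul_pos hD hC))
  refine ⟨M, fun w v hwv b hb hne => ?_⟩
  obtain ⟨x, hxB, hxA⟩ := hne
  intro y hy
  by_contra hyA
  have h1 := (h'' w x hxA y hyA).trans (h' (v ++ b) x hxB y hy)
  have h2 := hM b hb.ge
  rw [lt_div_iff₀ (mul_pos hD hC)] at h2
  rw [wordProd_append] at h1
  have h3 := h w v hwv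
  have h4 := hB.wordProd_pos b
  have h5 := hA.wordProd_pos w
  have h6 : D * (wordProd τ v * wordProd τ b) ≤ D * (C * wordProd ρ w * wordProd τ b) := by
    gcongr
  have h7 : wordProd τ b * (D * C) * wordProd ρ w < g * wordProd ρ w := by gcongr
  linarith

lemma isHull_prefix (hA : IsCylinderSystem ρ A) (hB : IsCylinderSystem τ B)
    {w u : List (Fin m)} {v v' : List (Fin n)} (hv : IsHull A B w v)
    (hv' : IsHull A B (w ++ u) v') : v <+: v' := by
  obtain ⟨x, hx⟩ := hA.nonempty (w ++ u)
  rcases hB.prefix_or_prefix (hv.1 (hA.append_subset _ _ hx)) (hv'.1 hx) with h | h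
  · exact h
  · obtain ⟨t, rfl⟩ := h
    cases t with
    | nil => simp
    | cons j t =>
      refine (hv'.2 j ?_).elim
      refine (hA.append_subset _ _).trans (hv.1.trans ?_)
      have : v' ++ j :: t = (v' ++ [j]) ++ t := by simp
      rw [this]
      exact hB.append_subset _ _

end IsCylinderSystem

/-! ### The self-similar mass of a set -/

section mass

variable {E : Type*} {n : ℕ}

/-- The total weight of the words `v b` with `b` of length `N` whose base point lies in `S`. -/
noncomputable def mass (p : Fin n → ℝ) (x : List (Fin n) → E) :
    ℕ → List (Fin n) → Set E → ℝ
  | 0, v, S => wordProd p v * S.indicator 1 (x v)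
  | N + 1, v, S => ∑ j, mass p x N (v ++ [j]) S

variable {p : Fin n → ℝ} {x : List (Fin n) → E}

lemma mass_nonneg (hp : ∀ j, 0 < p j) (N : ℕ) (v : List (Fin n)) (S : Set E) :
    0 ≤ mass p x N v S := by
  induction N generalizing v with
  | zero =>
    exact mul_nonneg (wordProd_pos hp v).le (Set.indicator_nonneg (fun _ _ => zero_le_one) _)
  | succ N ih => exact Finset.sum_nonneg fun j _ => ih _

lemma mass_iUnion {m : ℕ} (N : ℕ) (v : List (Fin n)) (S : Fin m → Set E)
    (hS : Pairwise fun i j => Disjoint (S i) (S j)) :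
    mass p x N v (⋃ j, S j) = ∑ j, mass p x N v (S j) := by
  induction N generalizing v with
  | zero =>
    simp only [mass, ← Finset.mul_sum]
    congr 1
    by_cases h : ∃ i, x v ∈ S i
    · obtain ⟨i, hi⟩ := h
      rw [Set.indicator_of_mem (Set.mem_iUnion.2 ⟨i, hi⟩), Finset.sum_eq_single i,
        Set.indicator_of_mem hi]
      · intro j _ hji
        exact Set.indicator_of_notMem (Set.disjoint_left.1 (hS hji.symm) hi) _
      · simp
    · push Not at h
      rw [Set.indicator_of_notMem (by simpa using h), Finset.sum_eq_zero]
      exact fun j _ => Set.indicator_of_notMem (h j) _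
  | succ N ih =>
    simp only [mass, ih]
    exact Finset.sum_comm

lemma mass_pos (hp : ∀ j, 0 < p j) {S : Set E} (v b : List (Fin n)) (hb : x (v ++ b) ∈ S) :
    0 < mass p x b.length v S := by
  induction b generalizing v with
  | nil =>
    rw [List.append_nil] at hb
    simp [mass, hb, wordProd_pos hp v]
  | cons j b ih =>
    refine Finset.sum_pos' (fun i _ => mass_nonneg hp _ _ _) ⟨j, Finset.mem_univ _, ih _ ?_⟩
    simpa using hb

/-- `Θ` depends on `N` alone, not on `v` or `S`. This is the source of finiteness in the rigidity
argument. -/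
lemma exists_finite_mass_eq (p : Fin n → ℝ) (x : List (Fin n) → E) (N : ℕ) :
    ∃ Θ : Set ℝ, Θ.Finite ∧ ∀ v S, ∃ β ∈ Θ, mass p x N v S = wordProd p v * β := by
  induction N with
  | zero =>
    refine ⟨{0, 1}, by simp, fun v S => ⟨S.indicator 1 (x v), ?_, rfl⟩⟩
    by_cases h : x v ∈ S <;> simp [h]
  | succ N ih =>
    obtain ⟨Θ, hΘ, h⟩ := ih
    refine ⟨(fun c : Fin n → ℝ => ∑ j, p j * c j) '' Set.univ.pi fun _ => Θ,
      (Set.Finite.pi' fun _ => hΘ).subset (by intro c hc; simpa using hc) |>.image _, fun v S => ?_⟩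
    choose c hc hc' using fun j => h (v ++ [j]) S
    refine ⟨_, ⟨c, by simpa using hc, rfl⟩, ?_⟩
    simp only [mass, hc', wordProd_append, wordProd_cons, wordProd_nil, mul_one, Finset.mul_sum,
      mul_assoc]

variable [MetricSpace E] {τ : Fin n → ℝ} {B : List (Fin n) → Set E}

lemma mass_eq_zero (hB : IsCylinderSystem τ B) (hx : ∀ v, x v ∈ B v) {S : Set E} (N : ℕ)
    (v : List (Fin n)) (h : Disjoint (B v) S) : mass p x N v S = 0 := by
  induction N generalizing v with
  | zero => simp [mass, Set.disjoint_left.1 h (hx v)]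
  | succ N ih =>
    exact Finset.sum_eq_zero fun j _ => ih _ (h.mono_left (hB.append_subset _ _))

lemma mass_append (hB : IsCylinderSystem τ B) (hx : ∀ v, x v ∈ B v) {S : Set E} (N : ℕ)
    (v u : List (Fin n)) (h : S ⊆ B (v ++ u)) :
    mass p x (N + u.length) v S = mass p x N (v ++ u) S := by
  induction u generalizing v with
  | nil => simp
  | cons j u ih =>
    have e : v ++ j :: u = (v ++ [j]) ++ u := by simp
    rw [e] at h ⊢
    rw [← ih _ h, List.length_cons, ← add_assoc, mass]
    refine Finset.sum_eq_single j (fun i _ hij => ?_) (by simp)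
    refine mass_eq_zero hB hx _ _ ?_
    exact (hB.disjoint_children v hij).mono_right (h.trans (hB.append_subset _ _))

lemma mass_of_subset (hp : ∑ j, p j = 1) (hB : IsCylinderSystem τ B) (hx : ∀ v, x v ∈ B v)
    {S : Set E} (N : ℕ) (v : List (Fin n)) (h : B v ⊆ S) : mass p x N v S = wordProd p v := by
  induction N generalizing v with
  | zero => simp [mass, h (hx v)]
  | succ N ih =>
    rw [mass, Finset.sum_congr rfl fun j _ => ih _ ((hB.append_subset _ _).trans h)]
    simp [← Finset.mul_sum, hp]

/-- Once `S` is a union of cylinders of depth `N` inside `B v`, refining further does not change the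
sampled mass. So `mass` stands in for the self-similar measure of `S ∩ B v`, and no limit is needed.
-/
lemma mass_add_of_saturated (hp : ∑ j, p j = 1) (hB : IsCylinderSystem τ B)
    (hx : ∀ v, x v ∈ B v) {S : Set E} (N K : ℕ) (v : List (Fin n))
    (h : ∀ b : List (Fin n), b.length = N → (B (v ++ b) ∩ S).Nonempty → B (v ++ b) ⊆ S) :
    mass p x (N + K) v S = mass p x N v S := by
  induction N generalizing v with
  | zero =>
    have h0 := h [] rfl
    rw [List.append_nil] at h0
    by_cases hne : (B v ∩ S).Nonempty
    · rw [mass_of_subset hp hB hx _ _ (h0 hne), mass_of_subset hp hB hx _ _ (h0 hne)]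
    · rw [← Set.disjoint_iff_inter_eq_empty.trans Set.not_nonempty_iff_eq_empty.symm] at hne
      rw [mass_eq_zero hB hx _ _ hne, mass_eq_zero hB hx _ _ hne]
  | succ N ih =>
    rw [show N + 1 + K = (N + K) + 1 by omega, mass, mass]
    refine Finset.sum_congr rfl fun j _ => ih _ fun b hb => ?_
    simpa using h (j :: b) (by simp [hb])

end mass

/-! ### Measure rigidity -/

section rigidity

variable {m n : ℕ}

/-- Summing the bounds over `k` generations multiplies them by the `k`-th power of `∑ r_j`, while
`ν` stays fixed. -/
lemma sum_eq_one_of_comparable {r : Fin m → ℝ} (hr : ∀ j, 0 < r j) {ν : List (Fin m) → ℝ}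
    (hν : ∀ w, ν w = ∑ j, ν (w ++ [j])) {c C : ℝ} (hc : 0 < c)
    (h : ∀ w, c * wordProd r w ≤ ν w ∧ ν w ≤ C * wordProd r w) : ∑ j, r j = 1 := by
  have hσ : 0 ≤ ∑ j, r j := Finset.sum_nonneg fun j _ => (hr j).le
  have key : ∀ k : ℕ, ∀ w, c * wordProd r w * (∑ j, r j) ^ k ≤ ν w ∧
      ν w ≤ C * wordProd r w * (∑ j, r j) ^ k := by
    intro k
    induction k with
    | zero => simpa using h
    | succ k ih =>
      have e : ∀ a w, a * wordProd r w * (∑ j, r j) ^ (k + 1)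
          = ∑ j, a * wordProd r (w ++ [j]) * (∑ j, r j) ^ k := by
        intro a w
        rw [← Finset.sum_mul]
        simp only [wordProd_append, wordProd_cons, wordProd_nil, mul_one, ← Finset.mul_sum]
        ring
      intro w
      rw [e, e, hν w]
      exact ⟨Finset.sum_le_sum fun j _ => (ih _).1, Finset.sum_le_sum fun j _ => (ih _).2⟩
  have hν0 : 0 < ν [] := by
    have := (h []).1
    simp only [wordProd_nil, mul_one] at this
    linarith
  refine le_antisymm ?_ ?_
  · by_contra! hlt
    obtain ⟨k, hk⟩ := pow_unbounded_of_one_lt (ν [] / c) hlt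
    rw [div_lt_iff₀ hc] at hk
    have := (key k []).1
    simp only [wordProd_nil, mul_one] at this
    linarith
  · by_contra! hlt
    have hC : 0 < C := by
      have := (h []).2
      simp only [wordProd_nil, mul_one] at this
      linarith
    obtain ⟨k, hk⟩ := exists_pow_lt_of_lt_one (div_pos hν0 hC) hlt
    rw [lt_div_iff₀ hC] at hk
    have := (key k []).2
    simp only [wordProd_nil, mul_one] at this
    linarith

/-- The deficit `S - q` is a nonnegative martingale, so each child contributes at most the deficit
of its parent. -/
lemma sub_mul_le_of_martingale {r : Fin m → ℝ} (hr : ∀ j, 0 < r j) (hr1 : ∑ j, r j = 1)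
    {q : List (Fin m) → ℝ} (hq : ∀ w, q w = ∑ j, r j * q (w ++ [j])) {S : ℝ}
    (hS : ∀ w, q w ≤ S) (w u : List (Fin m)) :
    wordProd r u * (S - q (w ++ u)) ≤ S - q w := by
  induction u generalizing w with
  | nil => simp
  | cons j u ih =>
    have h1 := ih (w ++ [j])
    have e : w ++ j :: u = (w ++ [j]) ++ u := by simp
    rw [e, wordProd_cons, mul_assoc]
    refine (mul_le_mul_of_nonneg_left h1 (hr j).le).trans ?_
    have e2 : S - q w = ∑ i, r i * (S - q (w ++ [i])) := by
      simp only [mul_sub, Finset.sum_sub_distrib, ← Finset.sum_mul, hr1, one_mul, ← hq w]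
    rw [e2]
    exact Finset.single_le_sum (f := fun i => r i * (S - q (w ++ [i])))
      (fun i _ => mul_nonneg (hr i).le (sub_nonneg.2 (hS _))) (Finset.mem_univ j)

/-- A bounded martingale on the tree of words, whose ratios over bounded distances take finitely
many values, is constant on subtrees of arbitrary height. -/
lemma exists_martingale_const {r : Fin m → ℝ} (hr : ∀ j, 0 < r j) (hr1 : ∑ j, r j = 1)
    {q : List (Fin m) → ℝ} (hq : ∀ w, q w = ∑ j, r j * q (w ++ [j])) {c C : ℝ} (hc : 0 < c)
    (hcC : ∀ w, c ≤ q w ∧ q w ≤ C) (l : ℕ)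
    (hfin : {t | ∃ w u : List (Fin m), u.length ≤ l ∧ t = q (w ++ u) / q w}.Finite) :
    ∃ w, ∀ u : List (Fin m), u.length ≤ l → q (w ++ u) = q w := by
  -- A finite set of ratios stays at a positive distance `ε` from `1`, apart from `1` itself.
  obtain ⟨ε, hε, hball⟩ : ∃ ε > 0, ∀ w u : List (Fin m), u.length ≤ l →
      |q (w ++ u) / q w - 1| < ε → q (w ++ u) / q w = 1 := by
    have hopen : IsOpen ({t | ∃ w u : List (Fin m), u.length ≤ l ∧ t = q (w ++ u) / q w} \ {1})ᶜ :=
      (hfin.subset Set.sdiff_subset).isClosed.isOpen_compl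
    obtain ⟨ε, hε, h⟩ := Metric.isOpen_iff.1 hopen 1 (by simp)
    refine ⟨ε, hε, fun w u hu hlt => ?_⟩
    by_contra hne
    exact h (show q (w ++ u) / q w ∈ Metric.ball 1 ε by rwa [Metric.mem_ball, Real.dist_eq])
      ⟨⟨w, u, hu, rfl⟩, hne⟩
  obtain ⟨u₀, -, hu₀⟩ := Set.exists_min_image {u : List (Fin m) | u.length ≤ l} (wordProd r)
    (List.finite_length_le _ l) ⟨[], by simp⟩
  have hκ := wordProd_pos hr u₀
  have hκ1 : wordProd r u₀ ≤ 1 := by simpa using hu₀ [] (by simp)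
  have hbdd : BddAbove (Set.range q) := ⟨C, by rintro _ ⟨w, rfl⟩; exact (hcC w).2⟩
  have hS : ∀ w, q w ≤ sSup (Set.range q) := fun w => le_csSup hbdd ⟨w, rfl⟩
  set S := sSup (Set.range q)
  -- The root is chosen so close to the supremum that, after division by the least weight of a word
  -- of length at most `l`, every deficit in the subtree is still below `ε * c`.
  obtain ⟨_, ⟨w, rfl⟩, hw⟩ := exists_lt_of_lt_csSup (Set.range_nonempty q)
    (sub_lt_self S (mul_pos hκ (mul_pos hε hc)))
  refine ⟨w, fun u hu => ?_⟩
  have hqw : 0 < q w := hc.trans_le (hcC w).1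
  have hqwu : 0 ≤ S - q (w ++ u) := sub_nonneg.2 (hS _)
  have h1 := sub_mul_le_of_martingale hr hr1 hq hS w u
  have h2 : S - q (w ++ u) < ε * c := by
    have h3 : wordProd r u₀ * (S - q (w ++ u)) < wordProd r u₀ * (ε * c) :=
      (mul_le_mul_of_nonneg_right (hu₀ u hu) hqwu).trans_lt (by linarith)
    exact lt_of_mul_lt_mul_left h3 hκ.le
  have h4 : S - q w < ε * c := by
    have : wordProd r u₀ * (ε * c) ≤ ε * c := mul_le_of_le_one_left (by positivity) hκ1
    linarith
  have h5 : |q (w ++ u) / q w - 1| < ε := by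
    rw [div_sub_one hqw.ne', abs_div, abs_of_pos hqw, div_lt_iff₀ hqw]
    have h6 : ε * c ≤ ε * q w := mul_le_mul_of_nonneg_left (hcC w).1 hε.le
    have := hS w
    rw [abs_lt]
    constructor <;> linarith
  have h6 := hball w u hu h5
  rwa [div_eq_one_iff_eq hqw.ne'] at h6

end rigidity

/-- Two cylinder systems in the same space, with weights `ρ_j ^ δ` and `τ_k ^ δ`: the words of the
first one can be coded by words of the second one whose ratio differs by a factor from a fixed
finite set, and the coding is injective on antichains. -/
theorem exists_rigid_coding {E : Type*} [MetricSpace E] {m n : ℕ} [Nontrivial (Fin m)]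
    {ρ : Fin m → ℝ} {τ : Fin n → ℝ} {A : List (Fin m) → Set E} {B : List (Fin n) → Set E}
    (hA : IsCylinderSystem ρ A) (hB : IsCylinderSystem τ B) {δ : ℝ} (hδ : 0 < δ)
    (hτ : ∑ j, τ j ^ δ = 1) :
    ∃ D : Set ℝ, D.Finite ∧ ∀ l : ℕ, ∃ V : List (Fin m) → List (Fin n),
      (∀ u : List (Fin m), u.length ≤ l → wordProd τ (V u) / wordProd ρ u ∈ D) ∧
      ∀ u u' : List (Fin m), u.length ≤ l → u'.length ≤ l → V u = V u' → u <+: u' ∨ u' <+: u := by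
  choose h hh using hA.exists_isHull hB
  obtain ⟨M, hM⟩ := hA.exists_saturated hB
  choose x hx using hB.nonempty
  obtain ⟨c, hc, hc'⟩ := hA.exists_mul_le_of_subset hB
  obtain ⟨C, hC, hC'⟩ := hA.exists_le_mul_of_isHull hB
  set p : Fin n → ℝ := fun j => τ j ^ δ with hp
  set r : Fin m → ℝ := fun j => ρ j ^ δ with hr
  have hp0 : ∀ j, 0 < p j := fun j => Real.rpow_pos_of_pos (hB.ratio_pos j) _
  have hr0 : ∀ j, 0 < r j := fun j => Real.rpow_pos_of_pos (hA.ratio_pos j) _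
  have hpw : ∀ v, wordProd p v = wordProd τ v ^ δ := wordProd_rpow hB.ratio_pos δ
  have hrw : ∀ w, wordProd r w = wordProd ρ w ^ δ := wordProd_rpow hA.ratio_pos δ
  have hρ0 := hA.wordProd_pos
  have hτ0 := hB.wordProd_pos
  obtain ⟨Θ, hΘ, hmass⟩ := exists_finite_mass_eq p x M
  choose β hβ hβν using fun w => hmass (h w) (A w)
  set ν : List (Fin m) → ℝ := fun w => mass p x M (h w) (A w) with hν
  -- `ν w` can be computed from the root at any sufficiently large depth. A depth common to `w` and
  -- its children then gives additivity.
  have hνK : ∀ w K, M + (h w).length ≤ K → mass p x K [] (A w) = ν w := by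
    intro w K hK
    obtain ⟨K', rfl⟩ := Nat.exists_eq_add_of_le hK
    rw [show M + (h w).length + K' = M + K' + (h w).length by omega,
      mass_append hB hx _ [] (h w) (by simpa using (hh w).1), List.nil_append]
    exact mass_add_of_saturated hτ hB hx _ _ _ (hM w _ (hh w))
  have hνadd : ∀ w, ν w = ∑ j, ν (w ++ [j]) := by
    intro w
    set K := M + (h w).length + ∑ j, (M + (h (w ++ [j])).length) with hKdef
    have h1 : ∀ j, M + (h (w ++ [j])).length ≤ K := fun j =>
      (Finset.single_le_sum (f := fun j => M + (h (w ++ [j])).length)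
        (fun _ _ => Nat.zero_le _) (Finset.mem_univ j)).trans (Nat.le_add_left _ _)
    rw [← hνK w K (Nat.le_add_right _ _), Finset.sum_congr rfl fun j _ => (hνK (w ++ [j]) K (h1 j)).symm]
    conv_lhs => rw [hA.split w]
    exact mass_iUnion K [] _ fun i j hij => hA.disjoint_children w hij
  have hb : ∀ w, ∃ b : List (Fin n), b.length = M ∧ B (h w ++ b) ⊆ A w := by
    intro w
    obtain ⟨y, hy⟩ := hA.nonempty w
    obtain ⟨b, hb, hyb⟩ := hB.exists_mem_append ((hh w).1 hy) M
    exact ⟨b, hb, hM w _ (hh w) b hb ⟨y, hyb, hy⟩⟩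
  choose b hbM hbA using hb
  have hβ0 : ∀ w, 0 < β w := by
    intro w
    have h1 := mass_pos hp0 (h w) (b w) (hbA w (hx _))
    rw [hbM, hβν] at h1
    exact (mul_pos_iff_of_pos_left (wordProd_pos hp0 _)).1 h1
  have hfinβ : (Set.range β).Finite := hΘ.subset (by rintro _ ⟨w, rfl⟩; exact hβ w)
  obtain ⟨w₀, hw₀⟩ : ∃ w₀, ∀ w, β w₀ ≤ β w := by
    obtain ⟨_, ⟨w₀, rfl⟩, h1⟩ := Set.exists_min_image _ id hfinβ (Set.range_nonempty β)
    exact ⟨w₀, fun w => h1 _ ⟨w, rfl⟩⟩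
  obtain ⟨w₁, hw₁⟩ : ∃ w₁, ∀ w, β w ≤ β w₁ := by
    obtain ⟨_, ⟨w₀, rfl⟩, h1⟩ := Set.exists_max_image _ id hfinβ (Set.range_nonempty β)
    exact ⟨w₀, fun w => h1 _ ⟨w, rfl⟩⟩
  have hcomp : ∀ w, (c ^ δ * β w₀) * wordProd r w ≤ ν w ∧
      ν w ≤ (C ^ δ * β w₁) * wordProd r w := by
    intro w
    have h1 : c ^ δ * wordProd r w ≤ wordProd p (h w) := by
      rw [hpw, hrw, ← Real.mul_rpow hc.le (hρ0 w).le]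
      exact Real.rpow_le_rpow (mul_pos hc (hρ0 w)).le (hc' w _ (hh w).1) hδ.le
    have h2 : wordProd p (h w) ≤ C ^ δ * wordProd r w := by
      rw [hpw, hrw, ← Real.mul_rpow hC.le (hρ0 w).le]
      exact Real.rpow_le_rpow (hτ0 _).le (hC' w _ (hh w)) hδ.le
    rw [show ν w = wordProd p (h w) * β w from hβν w]
    constructor
    · calc _ = c ^ δ * wordProd r w * β w₀ := by ring
        _ ≤ _ := mul_le_mul h1 (hw₀ w) (hβ0 _).le (wordProd_pos hp0 _).le
    · calc _ ≤ C ^ δ * wordProd r w * β w₁ := mul_le_mul h2 (hw₁ w) (hβ0 _).le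
            ((wordProd_pos hp0 _).le.trans h2)
        _ = _ := by ring
  have hc0 : 0 < c ^ δ * β w₀ := mul_pos (Real.rpow_pos_of_pos hc _) (hβ0 _)
  have hr1 : ∑ j, r j = 1 := sum_eq_one_of_comparable hr0 hνadd hc0 hcomp
  have hpre := fun w u => hA.isHull_prefix hB (hh w) (hh (w ++ u))
  choose v' hv' using hpre
  set q : List (Fin m) → ℝ := fun w => ν w / wordProd r w with hq
  have hr0w := wordProd_pos hr0
  have hqmart : ∀ w, q w = ∑ j, r j * q (w ++ [j]) := by
    intro w
    simp only [hq]
    rw [hνadd w, Finset.sum_div]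
    refine Finset.sum_congr rfl fun j _ => ?_
    have := (hr0w w).ne'
    have := (hr0 j).ne'
    rw [wordProd_append, wordProd_cons, wordProd_nil]
    field_simp
  have hqbd : ∀ w, c ^ δ * β w₀ ≤ q w ∧ q w ≤ C ^ δ * β w₁ := fun w =>
    ⟨(le_div_iff₀ (hr0w w)).2 (hcomp w).1, (div_le_iff₀ (hr0w w)).2 (hcomp w).2⟩
  have hratio : ∀ w u, q (w ++ u) / q w =
      (wordProd τ (v' w u) / wordProd ρ u) ^ δ * (β (w ++ u) / β w) := by
    intro w u
    have h1 := (hβ0 w).ne'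
    have h2 := (hr0w w).ne'
    have h3 := (hr0w u).ne'
    have h4 := (wordProd_pos hp0 (h w)).ne'
    rw [Real.div_rpow (hτ0 _).le (hρ0 _).le, ← hpw, ← hrw]
    simp only [hq]
    rw [show ν w = wordProd p (h w) * β w from hβν w,
      show ν (w ++ u) = wordProd p (h (w ++ u)) * β (w ++ u) from hβν (w ++ u), ← hv' w u,
      wordProd_append, wordProd_append]
    field_simp
  -- The factors have the form `(β w / β (w ++ u)) ^ (1 / δ) * τ_b`. This set is fixed before `l`,
  -- although the root `w` of the subtree depends on `l`.
  refine ⟨(fun t : ℝ × ℝ × List (Fin n) => (t.1 / t.2.1) ^ (1 / δ) * wordProd τ t.2.2) ''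
    (Θ ×ˢ Θ ×ˢ {b | b.length ≤ M}),
    (hΘ.prod (hΘ.prod (List.finite_length_le _ M))).image _, fun l => ?_⟩
  have hfin : {t | ∃ w u : List (Fin m), u.length ≤ l ∧ t = q (w ++ u) / q w}.Finite := by
    obtain ⟨u₀, -, hu₀⟩ := Set.exists_min_image {u : List (Fin m) | u.length ≤ l} (wordProd ρ)
      (List.finite_length_le _ l) ⟨[], by simp⟩
    -- The hull grows by a bounded number of letters: comparability gives `τ_{v'} ≥ (c / C) * ρ_u`,
    -- and `ρ_u` is bounded below for words of length at most `l`.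
    obtain ⟨N, hN⟩ := exists_wordProd_lt hB.ratio (mul_pos (div_pos hc hC) (hρ0 u₀))
    have hlen : ∀ w u, u.length ≤ l → (v' w u).length ≤ N := by
      intro w u hu
      by_contra! hlt
      have h1 := hN _ hlt.le
      have h2 := hc' _ _ (hh (w ++ u)).1
      have h3 := hC' _ _ (hh w)
      rw [← hv' w u, wordProd_append, wordProd_append] at h2
      have h4 : c * (wordProd ρ w * wordProd ρ u) ≤
          C * wordProd ρ w * wordProd τ (v' w u) :=
        h2.trans (mul_le_mul_of_nonneg_right h3 (hτ0 _).le)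
      have h5 : c * wordProd ρ u ≤ C * wordProd τ (v' w u) := by
        refine le_of_mul_le_mul_left ?_ (hρ0 w)
        linarith
      have h6 := hu₀ u hu
      rw [div_mul_eq_mul_div, lt_div_iff₀ hC] at h1
      have h7 := mul_le_mul_of_nonneg_left h6 hc.le
      linarith
    refine (((List.finite_length_le (Fin m) l).prod ((List.finite_length_le (Fin n) N).prod
      (hΘ.prod hΘ))).image (fun t : List (Fin m) × List (Fin n) × ℝ × ℝ =>
        (wordProd τ t.2.1 / wordProd ρ t.1) ^ δ * (t.2.2.1 / t.2.2.2))).subset ?_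
    rintro _ ⟨w, u, hu, rfl⟩
    exact ⟨(u, v' w u, β (w ++ u), β w), ⟨hu, hlen w u hu, hβ _, hβ _⟩, (hratio w u).symm⟩
  obtain ⟨w, hw⟩ := exists_martingale_const hr0 hr1 hqmart hc0 hqbd l hfin
  -- Appending `b` replaces the hull by a cylinder contained in `A (w ++ u)`. Equal codes therefore
  -- give intersecting cylinders of the first system, hence prefix-comparable words.
  refine ⟨fun u => v' w u ++ b (w ++ u), fun u hu => ?_, fun u u' hu hu' hV => ?_⟩
  · refine ⟨(β w, β (w ++ u), b (w ++ u)), ⟨hβ _, hβ _, (hbM _).le⟩, ?_⟩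
    have h1 := hratio w u
    rw [hw u hu, div_self (hc0.trans_le (hqbd w).1).ne'] at h1
    have h2 : β w / β (w ++ u) = (wordProd τ (v' w u) / wordProd ρ u) ^ δ := by
      have := (hβ0 w).ne'
      have := (hβ0 (w ++ u)).ne'
      rw [div_eq_iff this]
      field_simp at h1
      linarith
    simp only [h2, wordProd_append]
    rw [← Real.rpow_mul (div_pos (hτ0 _) (hρ0 _)).le, mul_one_div_cancel hδ.ne', Real.rpow_one]
    ring
  · obtain ⟨y, hy⟩ := hB.nonempty (h (w ++ u) ++ b (w ++ u))
    have e : h (w ++ u) ++ b (w ++ u) = h (w ++ u') ++ b (w ++ u') := by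
      rw [← hv' w u, ← hv' w u', List.append_assoc, List.append_assoc]
      exact congrArg _ hV
    exact hA.prefix_or_prefix_of_mem_append w u u' (hbA _ hy) (hbA _ (e ▸ hy))

/-! ### Words, positions and multiplicities -/

section Frobenius

variable {m s : ℕ} {X : Fin m → Fin s → ℤ}

@[simp] lemma position_nil (X : Fin m → Fin s → ℤ) : position X [] = 0 := rfl

@[simp] lemma position_cons (X : Fin m → Fin s → ℤ) (j : Fin m) (w : List (Fin m)) :
    position X (j :: w) = X j + position X w := by simp [position]

@[simp] lemma position_append (X : Fin m → Fin s → ℤ) (u w : List (Fin m)) :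
    position X (u ++ w) = position X u + position X w := by simp [position]

lemma position_eq_multiset_sum (X : Fin m → Fin s → ℤ) (w : List (Fin m)) :
    position X w = ((w : Multiset (Fin m)).map X).sum := by simp [position]

lemma exists_position_iff {z : Fin s → ℤ} : (∃ w, position X w = z) ↔ z ∈ semigroup X := by
  constructor
  · rintro ⟨w, rfl⟩
    refine ⟨fun j => w.count j, ?_⟩
    induction w with
    | nil => simp
    | cons i w ih =>
      rw [position_cons, ih]
      simp only [List.count_cons, add_smul, Finset.sum_add_distrib, beq_iff_eq, ite_smul,
        one_smul, zero_smul, Finset.sum_ite_eq, Finset.mem_univ, if_true]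
      rw [add_comm]
  · rintro ⟨a, rfl⟩
    let S : AddSubmonoid (Fin s → ℤ) :=
      { carrier := {z | ∃ w, position X w = z}
        zero_mem' := ⟨[], rfl⟩
        add_mem' := by
          rintro _ _ ⟨u, rfl⟩ ⟨w, rfl⟩
          exact ⟨u ++ w, position_append X u w⟩ }
    exact S.sum_mem fun j _ => S.nsmul_mem (show X j ∈ S from ⟨[j], by simp⟩) _

lemma position_mem_semigroup (X : Fin m → Fin s → ℤ) (w : List (Fin m)) :
    position X w ∈ semigroup X := exists_position_iff.1 ⟨w, rfl⟩

lemma multiset_sum_mem_semigroup (X : Fin m → Fin s → ℤ) (B : Multiset (Fin m)) :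
    (B.map X).sum ∈ semigroup X := by
  induction B using Quotient.inductionOn with
  | h w => simpa [position] using position_mem_semigroup X w

lemma exists_multiset_of_mem_semigroup {z : Fin s → ℤ} (hz : z ∈ semigroup X) :
    ∃ B : Multiset (Fin m), (B.map X).sum = z := by
  obtain ⟨w, rfl⟩ := exists_position_iff.2 hz
  exact ⟨w, (position_eq_multiset_sum X w).symm⟩

variable {ℓ : (Fin s → ℤ) →+ ℝ}

lemma exists_mul_length_le (hℓ : ∀ j, 0 < ℓ (X j)) :
    ∃ c > 0, ∀ w : List (Fin m), c * w.length ≤ ℓ (position X w) := by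
  obtain ⟨c, hc, h⟩ : ∃ c > 0, ∀ j, c ≤ ℓ (X j) := by
    rcases isEmpty_or_nonempty (Fin m) with h | h
    · exact ⟨1, one_pos, fun j => h.elim j⟩
    · obtain ⟨i, hi⟩ := Finite.exists_min fun j => ℓ (X j)
      exact ⟨_, hℓ i, hi⟩
  refine ⟨c, hc, fun w => ?_⟩
  induction w with
  | nil => simp
  | cons j w ih =>
    rw [position_cons, map_add, List.length_cons]
    push_cast
    linarith [h j]

lemma exists_length_le (hℓ : ∀ j, 0 < ℓ (X j)) (z : Fin s → ℤ) :
    ∃ L : ℕ, ∀ w, position X w = z → w.length ≤ L := by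
  obtain ⟨c, hc, h⟩ := exists_mul_length_le hℓ
  refine ⟨⌈ℓ z / c⌉₊, fun w hw => ?_⟩
  have h1 := h w
  rw [hw, mul_comm, ← le_div_iff₀ hc] at h1
  exact_mod_cast h1.trans (Nat.le_ceil _)

lemma finite_position_eq (hℓ : ∀ j, 0 < ℓ (X j)) (z : Fin s → ℤ) :
    {w | position X w = z}.Finite := by
  obtain ⟨L, hL⟩ := exists_length_le hℓ z
  exact (List.finite_length_le (Fin m) L).subset hL

lemma latticeMultiplicity_pos (hℓ : ∀ j, 0 < ℓ (X j)) {z : Fin s → ℤ} :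
    0 < latticeMultiplicity X z ↔ z ∈ semigroup X := by
  rw [latticeMultiplicity, Set.ncard_pos (finite_position_eq hℓ z), ← exists_position_iff]
  rfl

lemma eq_of_prefix_of_position_eq (hℓ : ∀ j, 0 < ℓ (X j)) {u w : List (Fin m)} (h : u <+: w)
    (huw : position X u = position X w) : u = w := by
  obtain ⟨t, rfl⟩ := h
  obtain ⟨c, hc, h⟩ := exists_mul_length_le hℓ
  have h1 := h t
  rw [position_append, left_eq_add] at huw
  rw [huw, map_zero] at h1
  have h2 : (t.length : ℝ) ≤ 0 := by
    by_contra! h3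
    linarith [mul_pos hc h3]
  have h3 : t.length = 0 := by exact_mod_cast le_antisymm h2 (Nat.cast_nonneg _)
  simp [List.length_eq_zero_iff.1 h3]

/-- Concatenation is injective here: of all prefixes of a word, at most one has position `z`. -/
lemma latticeMultiplicity_mul_le (hℓ : ∀ j, 0 < ℓ (X j)) (z z' : Fin s → ℤ) :
    latticeMultiplicity X z * latticeMultiplicity X z' ≤ latticeMultiplicity X (z + z') := by
  rw [latticeMultiplicity, latticeMultiplicity, ← Set.ncard_prod]
  refine Set.ncard_le_ncard_of_injOn (fun t => t.1 ++ t.2) ?_ ?_ (finite_position_eq hℓ _)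
  · rintro ⟨u, w⟩ ⟨hu, hw⟩
    simp only [Set.mem_ofPred_eq] at hu hw ⊢
    rw [position_append, hu, hw]
  · rintro ⟨u, w⟩ ⟨hu, hw⟩ ⟨u', w'⟩ ⟨hu', hw'⟩ heq
    simp only [Set.mem_ofPred_eq] at hu hw hu' hw' heq
    have huu' : u = u' := by
      rcases List.prefix_or_prefix_of_prefix (List.prefix_append u w)
        (heq ▸ List.prefix_append u' w') with h | h
      · exact eq_of_prefix_of_position_eq hℓ h (hu.trans hu'.symm)
      · exact (eq_of_prefix_of_position_eq hℓ h (hu'.trans hu.symm)).symm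
    subst huu'
    simpa using heq

lemma latticeMultiplicity_le_add (hℓ : ∀ j, 0 < ℓ (X j)) (z : Fin s → ℤ) {z' : Fin s → ℤ}
    (hz' : z' ∈ semigroup X) : latticeMultiplicity X z ≤ latticeMultiplicity X (z + z') :=
  (Nat.le_mul_of_pos_right _ ((latticeMultiplicity_pos hℓ).2 hz')).trans
    (latticeMultiplicity_mul_le hℓ z z')

/-- A bound for the number of words containing a prescribed multiset of letters. -/
lemma ncard_words_containing_le (hℓ : ∀ j, 0 < ℓ (X j)) (L : ℕ) (B : Multiset (Fin m))
    (y : Fin s → ℤ) :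
    {w : List (Fin m) | position X w = y ∧ w.length ≤ L ∧ B ≤ (w : Multiset (Fin m))}.ncard ≤
      (L + 1) ^ B.card * latticeMultiplicity X (y - (B.map X).sum) := by
  induction B using Multiset.induction generalizing y with
  | empty =>
    simp only [Multiset.card_zero, pow_zero, one_mul, Multiset.map_zero, Multiset.sum_zero,
      sub_zero]
    exact Set.ncard_le_ncard (fun w hw => hw.1) (finite_position_eq hℓ y)
  | cons j B ih =>
    -- Delete one occurrence of `j` and remember its place, for which there are at most `L + 1`
    -- choices.
    have hsub : {w : List (Fin m) | position X w = y ∧ w.length ≤ L ∧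
        (j ::ₘ B) ≤ (w : Multiset (Fin m))} ⊆
        ⋃ k ∈ Finset.range (L + 1), (fun w : List (Fin m) => w.take k ++ j :: w.drop k) ''
          {w : List (Fin m) | position X w = y - X j ∧ w.length ≤ L ∧
            B ≤ (w : Multiset (Fin m))} := by
      rintro w ⟨hw, hwL, hwB⟩
      have hj : j ∈ w := Multiset.mem_coe.1 (Multiset.mem_of_le hwB (Multiset.mem_cons_self j B))
      obtain ⟨u, v, rfl⟩ := List.append_of_mem hj
      simp only [List.length_append, List.length_cons] at hwL
      simp only [position_append, position_cons] at hw
      refine Set.mem_biUnion (show u.length ∈ Finset.range (L + 1) by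
        rw [Finset.mem_range]; omega) ⟨u ++ v, ⟨?_, ?_, ?_⟩, by simp⟩
      · rw [position_append, ← hw]; abel
      · rw [List.length_append]; omega
      · rw [Multiset.coe_eq_coe.2 (List.perm_middle (l₁ := u) (a := j) (l₂ := v)),
          ← Multiset.cons_coe, Multiset.cons_le_cons_iff] at hwB
        exact hwB
    have hfin : {w : List (Fin m) | position X w = y - X j ∧ w.length ≤ L ∧
        B ≤ (w : Multiset (Fin m))}.Finite :=
      (finite_position_eq hℓ _).subset fun w hw => hw.1
    refine (Set.ncard_le_ncard hsub
      ((Finset.range (L + 1)).finite_toSet.biUnion fun k _ => hfin.image _)).trans ?_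
    refine (Finset.set_ncard_biUnion_le _ _).trans ?_
    refine (Finset.sum_le_card_nsmul _ _ _ fun k _ =>
      (Set.ncard_image_le hfin).trans (ih (y - X j))).trans ?_
    rw [Finset.card_range, smul_eq_mul, Multiset.card_cons, pow_succ', mul_assoc,
      Multiset.map_cons, Multiset.sum_cons, sub_sub]

/-- Dickson's lemma for multisets. -/
instance multiset_wellQuasiOrderedLE {α : Type*} [Finite α] :
    WellQuasiOrderedLE (Multiset α) where
  wqo f := by
    classical
    obtain ⟨i, j, hij, h⟩ := wellQuasiOrdered_le (fun k => Finsupp.orderIsoMultiset.symm (f k))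
    exact ⟨i, j, hij, Finsupp.orderIsoMultiset.symm.le_iff_le.1 h⟩

/-- An up-set of multisets has finitely many minimal elements, and they dominate it. -/
lemma exists_finset_multiset_le (P : Multiset (Fin m) → Prop) :
    ∃ F : Finset (Multiset (Fin m)), (∀ B ∈ F, P B) ∧ ∀ B, P B → ∃ B' ∈ F, B' ≤ B := by
  have hfin : {B | Minimal P B}.Finite :=
    WellQuasiOrderedLE.finite_of_isAntichain (setOfPred_minimal_antichain P)
  refine ⟨hfin.toFinset, fun B hB => ?_, fun B hB => ?_⟩
  · exact ((Set.Finite.mem_toFinset hfin).1 hB).prop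
  · obtain ⟨B', hle, hmin⟩ := exists_minimal_le_of_wellFoundedLT P B hB
    exact ⟨B', (Set.Finite.mem_toFinset hfin).2 hmin, hle⟩

/-- Multiplicities of lattice points at a bounded distance are polynomially comparable. -/
lemma exists_latticeMultiplicity_add_le (hℓ : ∀ j, 0 < ℓ (X j)) (e : Fin s → ℤ) :
    ∃ C : ℕ, ∀ z ∈ semigroup X, ∀ L : ℕ, (∀ w, position X w = z + e → w.length ≤ L) →
      latticeMultiplicity X (z + e) ≤ C * (L + 1) ^ C * latticeMultiplicity X z := by
  -- Every word over `z + e` contains some `B` from a finite list independent of `z`. Deleting the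
  -- letters of `B` leads to `z + e - ∑ B`, and adding the semigroup element `∑ B - e` returns to
  -- `z` without decreasing the multiplicity.
  obtain ⟨F, hF, hF'⟩ := exists_finset_multiset_le
    fun B : Multiset (Fin m) => (B.map X).sum - e ∈ semigroup X
  refine ⟨F.card + ∑ B ∈ F, B.card, fun z hz L hL => ?_⟩
  have hsub : {w | position X w = z + e} ⊆ ⋃ B ∈ F, {w : List (Fin m) | position X w = z + e ∧
      w.length ≤ L ∧ B ≤ (w : Multiset (Fin m))} := by
    intro w hw
    obtain ⟨B, hB, hle⟩ := hF' (w : Multiset (Fin m)) (by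
      rw [← position_eq_multiset_sum, show position X w = z + e from hw, add_sub_cancel_right]
      exact hz)
    exact Set.mem_biUnion hB ⟨hw, hL w hw, hle⟩
  have hfin : (⋃ B ∈ F, {w : List (Fin m) | position X w = z + e ∧
      w.length ≤ L ∧ B ≤ (w : Multiset (Fin m))}).Finite :=
    F.finite_toSet.biUnion fun B _ => (finite_position_eq hℓ _).subset fun w hw => hw.1
  refine (Set.ncard_le_ncard hsub hfin).trans ((Finset.set_ncard_biUnion_le _ _).trans ?_)
  have hterm : ∀ B ∈ F, {w : List (Fin m) | position X w = z + e ∧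
      w.length ≤ L ∧ B ≤ (w : Multiset (Fin m))}.ncard ≤
      (L + 1) ^ (F.card + ∑ B ∈ F, B.card) * latticeMultiplicity X z := by
    intro B hB
    refine (ncard_words_containing_le hℓ L B _).trans (Nat.mul_le_mul ?_ ?_)
    · refine Nat.pow_le_pow_right (Nat.succ_pos _) ?_
      exact (Finset.single_le_sum (f := fun B : Multiset (Fin m) => B.card)
        (fun _ _ => Nat.zero_le _) hB).trans (Nat.le_add_left _ _)
    · have h1 := latticeMultiplicity_le_add hℓ (z + e - (B.map X).sum) (hF B hB)
      rwa [show z + e - (B.map X).sum + ((B.map X).sum - e) = z by abel] at h1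
  refine (Finset.sum_le_card_nsmul _ _ _ hterm).trans ?_
  rw [smul_eq_mul, mul_assoc]
  exact Nat.mul_le_mul_right _ (Nat.le_add_right _ _)

end Frobenius

/-! ### Lattice points near a point of the cone -/

section Euclidean

variable {m n s : ℕ} {X : Fin m → Fin s → ℤ} {Y : Fin n → Fin s → ℤ}

@[simp] lemma toEuclid_apply (z : Fin s → ℤ) (i : Fin s) : toEuclid z i = (z i : ℝ) := rfl

/-- The inclusion `ℤˢ ⊆ ℝˢ` as an additive homomorphism. -/
noncomputable def toEuclidHom (s : ℕ) : (Fin s → ℤ) →+ EuclideanSpace ℝ (Fin s) where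
  toFun := toEuclid
  map_zero' := by ext i; simp
  map_add' x y := by ext i; simp

lemma toEuclid_add (x y : Fin s → ℤ) : toEuclid (x + y) = toEuclid x + toEuclid y :=
  map_add (toEuclidHom s) x y

lemma toEuclid_sub (x y : Fin s → ℤ) : toEuclid (x - y) = toEuclid x - toEuclid y :=
  map_sub (toEuclidHom s) x y

lemma toEuclid_nsmul (k : ℕ) (x : Fin s → ℤ) : toEuclid (k • x) = (k : ℝ) • toEuclid x := by
  rw [Nat.cast_smul_eq_nsmul]
  exact map_nsmul (toEuclidHom s) k x

lemma toEuclid_sum {ι : Type*} (t : Finset ι) (f : ι → Fin s → ℤ) :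
    toEuclid (∑ i ∈ t, f i) = ∑ i ∈ t, toEuclid (f i) :=
  map_sum (toEuclidHom s) f t

lemma abs_le_norm_toEuclid (z : Fin s → ℤ) (i : Fin s) : |(z i : ℝ)| ≤ ‖toEuclid z‖ := by
  have := PiLp.norm_apply_le (toEuclid z) i
  rwa [toEuclid_apply, Real.norm_eq_abs] at this

lemma finite_norm_toEuclid_le (s : ℕ) (R : ℝ) : {z : Fin s → ℤ | ‖toEuclid z‖ ≤ R}.Finite := by
  refine (Set.finite_Icc (fun _ : Fin s => -⌈R⌉) (fun _ => ⌈R⌉)).subset fun z hz => ?_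
  have h : ∀ i, |(z i : ℝ)| ≤ ⌈R⌉ := fun i =>
    (abs_le_norm_toEuclid z i).trans (le_trans hz (Int.le_ceil R))
  refine ⟨fun i => ?_, fun i => ?_⟩
  · exact_mod_cast (abs_le.1 (h i)).1
  · exact_mod_cast (abs_le.1 (h i)).2

lemma exists_addMonoidHom_le (ℓ : (Fin s → ℤ) →+ ℝ) :
    ∃ K : ℝ, 0 ≤ K ∧ ∀ z, ℓ z ≤ K * ‖toEuclid z‖ := by
  refine ⟨∑ i, |ℓ (Pi.single i 1)|, Finset.sum_nonneg fun _ _ => abs_nonneg _, fun z => ?_⟩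
  have hz : ℓ z = ∑ i, (z i : ℝ) * ℓ (Pi.single i 1) := by
    conv_lhs => rw [← Finset.univ_sum_single z]
    rw [map_sum]
    refine Finset.sum_congr rfl fun i _ => ?_
    rw [← zsmul_eq_mul, ← map_zsmul, ← Pi.single_smul]
    simp
  rw [hz, Finset.sum_mul]
  refine Finset.sum_le_sum fun i _ => (le_abs_self _).trans ?_
  rw [abs_mul, mul_comm]
  exact mul_le_mul_of_nonneg_left (abs_le_norm_toEuclid z i) (abs_nonneg _)

lemma smul_mem_cone {v : EuclideanSpace ℝ (Fin s)} (hv : v ∈ cone X) {a : ℝ} (ha : 0 ≤ a) :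
    a • v ∈ cone X := by
  obtain ⟨c, hc, rfl⟩ := hv
  exact ⟨fun j => a * c j, fun j => mul_nonneg ha (hc j), by simp [Finset.smul_sum, mul_smul]⟩

lemma cone_subset_cone (h : ∀ j, toEuclid (X j) ∈ cone Y) : cone X ⊆ cone Y := by
  rintro _ ⟨a, ha, rfl⟩
  choose c hc hc' using h
  refine ⟨fun k => ∑ j, a j * c j k,
    fun k => Finset.sum_nonneg fun j _ => mul_nonneg (ha j) (hc j k), ?_⟩
  simp only [Finset.sum_smul, mul_smul]
  rw [Finset.sum_comm]
  exact Finset.sum_congr rfl fun j _ => by rw [hc' j, Finset.smul_sum]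

lemma toEuclid_mem_cone_of_nsmul_mem {z : Fin s → ℤ} {k : ℕ} (hk : 0 < k)
    (h : k • z ∈ semigroup X) : toEuclid z ∈ cone X := by
  obtain ⟨a, ha⟩ := h
  have h1 : toEuclid (k • z) ∈ cone X := by
    refine ⟨fun j => a j, fun j => Nat.cast_nonneg _, ?_⟩
    rw [ha, toEuclid_sum]
    exact Finset.sum_congr rfl fun j _ => toEuclid_nsmul _ _
  have h2 := smul_mem_cone h1 (a := (k : ℝ)⁻¹) (by positivity)
  rwa [toEuclid_nsmul, inv_smul_smul₀ (by positivity)] at h2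

lemma exists_dist_semigroup_le (X : Fin m → Fin s → ℤ) :
    ∃ R : ℝ, ∀ x ∈ cone X, ∃ z ∈ semigroup X, dist x (toEuclid z) ≤ R := by
  refine ⟨∑ j, ‖toEuclid (X j)‖, ?_⟩
  rintro _ ⟨c, hc, rfl⟩
  refine ⟨_, ⟨fun j => ⌊c j⌋₊, rfl⟩, ?_⟩
  rw [toEuclid_sum, dist_eq_norm, ← Finset.sum_sub_distrib]
  refine (norm_sum_le _ _).trans (Finset.sum_le_sum fun j _ => ?_)
  rw [toEuclid_nsmul, ← sub_smul, norm_smul]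
  refine mul_le_of_le_one_left (norm_nonneg _) ?_
  rw [Real.norm_eq_abs, abs_le]
  constructor
  · linarith [Nat.floor_le (hc j)]
  · linarith [Nat.lt_floor_add_one (c j)]

lemma isClosed_image_toEuclid (S : Set (Fin s → ℤ)) : IsClosed (toEuclid '' S) := by
  refine Metric.isClosed_of_pairwise_le_dist one_pos ?_
  rintro _ ⟨x, -, rfl⟩ _ ⟨y, -, rfl⟩ hxy
  have hne : x ≠ y := fun h => hxy (h ▸ rfl)
  obtain ⟨i, hi⟩ := Function.ne_iff.1 hne
  rw [dist_eq_norm, ← toEuclid_sub]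
  refine le_trans ?_ (abs_le_norm_toEuclid (x - y) i)
  have h1 : (1 : ℤ) ≤ |(x - y) i| := Int.one_le_abs (by simpa [sub_eq_zero] using hi)
  exact_mod_cast h1

/-- A nearest semigroup point exists because the image of the semigroup is closed, so the infimum in
`multiplicity` is attained and is not the default value `0` of an empty set. -/
lemma exists_multiplicity_eq (X : Fin m → Fin s → ℤ) :
    ∃ R : ℝ, ∀ x ∈ cone X, ∃ z ∈ semigroup X, dist x (toEuclid z) ≤ R ∧
      multiplicity X x = latticeMultiplicity X z := by
  obtain ⟨R, hR⟩ := exists_dist_semigroup_le X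
  refine ⟨R, fun x hx => ?_⟩
  obtain ⟨z₀, hz₀, hz₀R⟩ := hR x hx
  obtain ⟨_, ⟨z₁, hz₁, rfl⟩, hz₁d⟩ :=
    (isClosed_image_toEuclid (semigroup X)).exists_infDist_eq_dist
      (Set.Nonempty.image _ ⟨z₀, hz₀⟩) x
  obtain ⟨z, ⟨hz, hzd⟩, hzm⟩ := Nat.sInf_mem (s := latticeMultiplicity X '' {z | z ∈ semigroup X ∧
    dist x (toEuclid z) = Metric.infDist x (toEuclid '' semigroup X)}) 
    (Set.Nonempty.image _ ⟨z₁, hz₁, hz₁d.symm⟩)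
  refine ⟨z, hz, ?_, hzm.symm⟩
  rw [hzd]
  exact (Metric.infDist_le_dist_of_mem (Set.mem_image_of_mem _ hz₀)).trans hz₀R

variable {ℓ : (Fin s → ℤ) →+ ℝ}

lemma exists_length_le_near (hℓ : ∀ j, 0 < ℓ (X j)) (θ : EuclideanSpace ℝ (Fin s)) (R : ℝ) :
    ∃ K : ℕ, ∀ (k : ℕ) (w : List (Fin m)),
      dist ((k : ℝ) • θ) (toEuclid (position X w)) ≤ R → w.length ≤ K * (k + 1) := by
  obtain ⟨c, hc, h⟩ := exists_mul_length_le hℓ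
  obtain ⟨K, hK, h'⟩ := exists_addMonoidHom_le ℓ
  refine ⟨⌈K * (‖θ‖ + |R|) / c⌉₊, fun k w hw => ?_⟩
  have h1 := (h w).trans (h' _)
  have h2 : ‖toEuclid (position X w)‖ ≤ (‖θ‖ + |R|) * (k + 1) := by
    have h3 : ‖toEuclid (position X w)‖ ≤ ‖(k : ℝ) • θ‖ + R := by
      rw [dist_eq_norm] at hw
      have := norm_le_norm_add_norm_sub ((k : ℝ) • θ) (toEuclid (position X w))
      linarith
    rw [norm_smul, Real.norm_natCast] at h3
    have h4 : 0 ≤ |R| * k := by positivity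
    have := norm_nonneg θ
    linarith [le_abs_self R]
  have h5 : c * w.length ≤ K * ((‖θ‖ + |R|) * (k + 1)) :=
    h1.trans (mul_le_mul_of_nonneg_left h2 hK)
  have h6 : (w.length : ℝ) ≤ K * (‖θ‖ + |R|) / c * (k + 1) := by
    rw [div_mul_eq_mul_div, le_div_iff₀ hc]
    linarith
  have h7 := h6.trans (mul_le_mul_of_nonneg_right (Nat.le_ceil (K * (‖θ‖ + |R|) / c))
    (by positivity : (0 : ℝ) ≤ k + 1))
  exact_mod_cast h7

lemma exists_latticeMultiplicity_le_near (hℓ : ∀ j, 0 < ℓ (X j))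
    (θ : EuclideanSpace ℝ (Fin s)) (R : ℝ) :
    ∃ C : ℕ, ∀ (k : ℕ), ∀ z ∈ semigroup X, ∀ z', dist ((k : ℝ) • θ) (toEuclid z) ≤ R →
      dist ((k : ℝ) • θ) (toEuclid z') ≤ R →
      latticeMultiplicity X z' ≤ C * (k + 1) ^ C * latticeMultiplicity X z := by
  obtain ⟨K, hK⟩ := exists_length_le_near hℓ θ R
  choose c hc using exists_latticeMultiplicity_add_le hℓ
  -- Two lattice points within `R` of `kθ` differ by one of finitely many vectors, so the constants
  -- can be made uniform.
  set F := (finite_norm_toEuclid_le s (2 * R)).toFinset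
  set C₀ := ∑ e ∈ F, c e
  refine ⟨C₀ * (K + 1) ^ C₀ + C₀, fun k z hz z' hzR hz'R => ?_⟩
  have he : z' - z ∈ F := by
    refine (Set.Finite.mem_toFinset _).2 ?_
    show ‖toEuclid (z' - z)‖ ≤ 2 * R
    rw [toEuclid_sub, ← dist_eq_norm]
    linarith [dist_triangle_left (toEuclid z') (toEuclid z) ((k : ℝ) • θ)]
  have h1 := hc (z' - z) z hz (K * (k + 1)) fun w hw => hK k w (by
    rw [hw, add_sub_cancel]; exact hz'R)
  rw [add_sub_cancel] at h1
  have h2 : c (z' - z) ≤ C₀ := Finset.single_le_sum (f := c) (fun _ _ => Nat.zero_le _) he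
  refine h1.trans (Nat.mul_le_mul_right _ ?_)
  calc c (z' - z) * (K * (k + 1) + 1) ^ c (z' - z)
      ≤ C₀ * ((K + 1) * (k + 1)) ^ C₀ := by
        refine Nat.mul_le_mul h2 ((Nat.pow_le_pow_left ?_ _).trans
          (Nat.pow_le_pow_right (by positivity) h2))
        nlinarith
    _ = C₀ * (K + 1) ^ C₀ * (k + 1) ^ C₀ := by rw [mul_pow, mul_assoc]
    _ ≤ _ := Nat.mul_le_mul (Nat.le_add_right _ _)
        (Nat.pow_le_pow_right (Nat.succ_pos _) (Nat.le_add_left _ _))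

lemma latticeMultiplicity_le_pow {z : Fin s → ℤ} {L : ℕ}
    (hL : ∀ w, position X w = z → w.length ≤ L) : latticeMultiplicity X z ≤ (m + 1) ^ L := by
  have h1 := Set.ncard_le_ncard_of_injOn (s := {w | position X w = z})
    -- Lookup returns `none` beyond the end, so a word of length at most `L` is determined by its
    -- first `L` lookups.
    (t := (Set.univ : Set (Fin L → Option (Fin m)))) (fun w i => w[(i : ℕ)]?)
    (fun _ _ => Set.mem_univ _) (by
      intro w hw w' hw' heq
      refine List.ext_getElem? fun i => ?_
      by_cases hi : i < L
      · exact congrFun heq ⟨i, hi⟩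
      · have h2 := hL w hw
        have h3 := hL w' hw'
        rw [List.getElem?_eq_none (by omega), List.getElem?_eq_none (by omega)])
  simpa [Set.ncard_univ, latticeMultiplicity] using h1

end Euclidean

/-! ### Almost superadditive sequences -/

lemma four_mul_sqrt_le {q₁ q₂ : ℝ} (h1 : 0 ≤ q₁) (h12 : q₁ ≤ q₂) (h2 : q₁ + q₂ ≤ 3 * q₁) :
    √(q₁ + q₂) ≤ 4 * (√q₁ + √q₂ - √(q₁ + q₂)) := by
  have h : √(q₁ + q₂) ≤ 4 / 5 * (√q₁ + √q₂) := by
    rw [Real.sqrt_le_left (by positivity)]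
    have e1 := Real.sq_sqrt h1
    have e2 := Real.sq_sqrt (h1.trans h12)
    have e3 : q₁ ≤ √q₁ * √q₂ := by
      calc q₁ = √q₁ * √q₁ := by rw [← sq, e1]
        _ ≤ _ := mul_le_mul_of_nonneg_left (Real.sqrt_le_sqrt h12) (Real.sqrt_nonneg _)
    nlinarith
  linarith

/-- Iterating almost superadditivity along a balanced tree. -/
lemma mul_le_of_almost_superadditive {g : ℕ → ℝ} {A : ℝ} (hA : 0 ≤ A)
    (h : ∀ k l, g k + g l ≤ g (k + l) + A * √(k + l + 1)) {k : ℕ} (hk : 1 ≤ k) (q : ℕ)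
    (hq : 1 ≤ q) : q * g k ≤ g (q * k) + 4 * A * √(2 * k) * (q - √q) := by
  -- The term `-√q` strengthens the induction: when `q` splits into nearly equal halves, `√q₁ + √q₂
  -- - √q` is at least `√q / 4`, which absorbs the new error.
  induction q using Nat.strong_induction_on with
  | _ q ih =>
    rcases hq.eq_or_lt with rfl | hq2
    · simp
    · obtain ⟨q₁, q₂, rfl, h1, h12, h2⟩ : ∃ q₁ q₂, q = q₁ + q₂ ∧ 1 ≤ q₁ ∧ q₁ ≤ q₂ ∧
          q₁ + q₂ ≤ 3 * q₁ := ⟨q / 2, q - q / 2, by omega, by omega, by omega, by omega⟩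
      have i1 := ih q₁ (by omega) h1
      have i2 := ih q₂ (by omega) (by omega)
      have i3 := h (q₁ * k) (q₂ * k)
      have i4 : √(((q₁ * k : ℕ) : ℝ) + ((q₂ * k : ℕ) : ℝ) + 1) ≤ √(2 * k) * √(q₁ + q₂) := by
        rw [← Real.sqrt_mul (by positivity)]
        refine Real.sqrt_le_sqrt ?_
        have : (1 : ℝ) ≤ (q₁ + q₂ : ℕ) * k := by
          exact_mod_cast Nat.mul_pos (by omega : 0 < q₁ + q₂) hk
        push_cast at this ⊢
        linarith
      have i5 := four_mul_sqrt_le (q₁ := q₁) (q₂ := q₂) (Nat.cast_nonneg _)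
        (by exact_mod_cast h12) (by exact_mod_cast h2)
      have i6 := mul_le_mul_of_nonneg_left i4 hA
      have i7 := mul_le_mul_of_nonneg_left i5 (mul_nonneg hA (Real.sqrt_nonneg (2 * (k : ℝ))))
      rw [← add_mul] at i3
      push_cast
      linarith

lemma tendsto_sqrt_div_atTop (c : ℝ) :
    Tendsto (fun n : ℕ => c * √(n + 1) / n) atTop (𝓝 0) := by
  have h1 : Tendsto (fun n : ℕ => |c| * √2 / √(n : ℝ)) atTop (𝓝 0) :=
    Tendsto.div_atTop tendsto_const_nhds
      (Real.tendsto_sqrt_atTop.comp tendsto_natCast_atTop_atTop)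
  refine squeeze_zero_norm' ?_ h1
  filter_upwards [eventually_ge_atTop 1] with n hn
  have hn' : (1 : ℝ) ≤ n := by exact_mod_cast hn
  have hs : 0 < √(n : ℝ) := Real.sqrt_pos.2 (by linarith)
  rw [norm_div, norm_mul, Real.norm_eq_abs, Real.norm_of_nonneg (Real.sqrt_nonneg _),
    Real.norm_natCast, div_le_div_iff₀ (by linarith) hs]
  have h2 : √((n : ℝ) + 1) ≤ √2 * √n := by
    rw [← Real.sqrt_mul (by norm_num)]
    exact Real.sqrt_le_sqrt (by linarith)
  calc |c| * √((n : ℝ) + 1) * √n ≤ |c| * (√2 * √n) * √n := by gcongr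
    _ = |c| * √2 * (√n * √n) := by ring
    _ = |c| * √2 * n := by rw [Real.mul_self_sqrt (by linarith)]

/-- A version of the theorem of de Bruijn and Erdős. -/
theorem exists_tendsto_of_almost_superadditive {g : ℕ → ℝ} {A M : ℝ} (hA : 0 ≤ A)
    (hg0 : ∀ k, 0 ≤ g k) (hgM : ∀ k, g k ≤ M * (k + 1))
    (h : ∀ k l, g k + g l ≤ g (k + l) + A * √(k + l + 1)) :
    ∃ L, Tendsto (fun k => g k / k) atTop (𝓝 L) := by
  have hM : 0 ≤ M := by have := (hg0 0).trans (hgM 0); simpa using this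
  have hbelow : ∀ k : ℕ, 0 ≤ g k / k := fun k => div_nonneg (hg0 k) (Nat.cast_nonneg _)
  have habove : ∀ k : ℕ, g k / k ≤ 2 * M := by
    intro k
    rcases Nat.eq_zero_or_pos k with rfl | hk
    · simpa using hM
    · have hk' : (1 : ℝ) ≤ k := by exact_mod_cast hk
      rw [div_le_iff₀ (by linarith)]
      nlinarith [hgM k]
  have hbA : IsBoundedUnder (· ≤ ·) atTop fun k => g k / k := isBoundedUnder_of ⟨_, habove⟩
  have hbB : IsBoundedUnder (· ≥ ·) atTop fun k => g k / k := isBoundedUnder_of ⟨_, hbelow⟩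
  set I := liminf (fun k => g k / k) atTop
  -- For fixed `k`, write `n` as `(n / k) * k + n % k`, drop the nonnegative term `g (n % k)`, and
  -- let `n` tend to infinity.
  have key : ∀ k : ℕ, 1 ≤ k → g k / k ≤ I + 4 * A * √(2 * k) / k := by
    intro k hk
    have hk' : (0 : ℝ) < k := by exact_mod_cast hk
    set b : ℕ → ℝ := fun n => ((n / k : ℕ) : ℝ) / n * (g k - 4 * A * √(2 * k)) -
      A * √(n + 1) / n
    have hb : Tendsto b atTop (𝓝 ((1 / k : ℝ) * (g k - 4 * A * √(2 * k)) - 0)) := by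
      refine Tendsto.sub (Tendsto.mul_const _ ?_) (tendsto_sqrt_div_atTop A)
      have h1 := (tendsto_nat_floor_mul_div_atTop (R := ℝ) (a := 1 / k) (by positivity)).comp
        tendsto_natCast_atTop_atTop
      refine h1.congr fun n => ?_
      simp only [Function.comp]
      rw [one_div_mul_eq_div, Nat.floor_div_eq_div]
    have hbg : ∀ᶠ n in atTop, b n ≤ g n / n := by
      filter_upwards [eventually_ge_atTop k] with n hn
      have hn' : (0 : ℝ) < n := by exact_mod_cast (hk.trans hn)
      have hq : 1 ≤ n / k := (Nat.one_le_div_iff hk).2 hn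
      have h1 := mul_le_of_almost_superadditive hA h hk (n / k) hq
      have h2 := h (n / k * k) (n % k)
      have h3 : n / k * k + n % k = n := Nat.div_add_mod' n k
      have h4 : (((n / k * k : ℕ) : ℝ) + ((n % k : ℕ) : ℝ)) = n := by exact_mod_cast h3
      rw [h3, h4] at h2
      have h5 := hg0 (n % k)
      have h6 : 0 ≤ 4 * A * √(2 * k) * √((n / k : ℕ) : ℝ) := by positivity
      rw [show b n = (((n / k : ℕ) : ℝ) * (g k - 4 * A * √(2 * k)) - A * √(n + 1)) / n by
        simp only [b]; ring]
      refine div_le_div_of_nonneg_right ?_ hn'.le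
      linarith
    have h1 := liminf_le_liminf hbg hb.isBoundedUnder_ge hbA.isCoboundedUnder_ge
    rw [hb.liminf_eq] at h1
    rw [← sub_le_iff_le_add]
    refine le_trans (le_of_eq ?_) h1
    ring
  have hlim : Tendsto (fun k : ℕ => I + 4 * A * √(2 * k) / k) atTop (𝓝 (I + 0)) := by
    refine tendsto_const_nhds.add ?_
    refine squeeze_zero' (Eventually.of_forall fun k => by positivity)
      (Eventually.of_forall fun k => ?_) (tendsto_sqrt_div_atTop (4 * A * √2))
    rw [Real.sqrt_mul (by norm_num), ← mul_assoc]
    gcongr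
    linarith
  refine ⟨I, tendsto_of_le_liminf_of_limsup_le le_rfl ?_ hbA hbB⟩
  have h1 := limsup_le_limsup (f := atTop) ((eventually_ge_atTop 1).mono key)
    hbB.isCoboundedUnder_le hlim.isBoundedUnder_le
  rwa [hlim.limsup_eq, add_zero] at h1

/-! ### Directional growth -/

section growth

variable {m n s : ℕ} {X : Fin m → Fin s → ℤ} {Y : Fin n → Fin s → ℤ} {ℓ : (Fin s → ℤ) →+ ℝ}

/-- The logarithm of a polynomial factor is coarsened to a multiple of `√(k + 1)`, the error shape
that the superadditivity argument handles. -/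
lemma log_le_log_add_sqrt {a b C₁ C₂ k : ℕ} (ha : 0 < a) (hb : 0 < b)
    (h : a ≤ C₁ * (k + 1) ^ C₂ * b) :
    Real.log a ≤ Real.log b + (C₁ + 2 * C₂) * √(k + 1) := by
  have hC : 0 < C₁ := by
    rcases Nat.eq_zero_or_pos C₁ with rfl | h'
    · simp at h; omega
    · exact h'
  have hC' : (0 : ℝ) < C₁ := by exact_mod_cast hC
  have hb' : (0 : ℝ) < b := by exact_mod_cast hb
  have hk : (0 : ℝ) < (k : ℝ) + 1 := by positivity
  have h1 : Real.log a ≤ Real.log (C₁ * (k + 1) ^ C₂ * b) :=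
    Real.log_le_log (by exact_mod_cast ha) (by exact_mod_cast h)
  rw [Real.log_mul (by positivity) hb'.ne', Real.log_mul hC'.ne' (by positivity),
    Real.log_pow] at h1
  have h2 : Real.log C₁ ≤ C₁ * √(k + 1) := by
    have h3 : 1 ≤ √((k : ℝ) + 1) := Real.one_le_sqrt.2 (by linarith [Nat.cast_nonneg (α := ℝ) k])
    have := Real.log_le_sub_one_of_pos hC'
    nlinarith
  have h3 : Real.log ((k : ℝ) + 1) ≤ 2 * √(k + 1) := by
    have h4 := Real.log_le_sub_one_of_pos (Real.sqrt_pos.2 hk)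
    rw [Real.log_sqrt hk.le] at h4
    linarith
  have h5 := mul_le_mul_of_nonneg_left h3 (Nat.cast_nonneg (α := ℝ) C₂)
  linarith

lemma natCast_smul_mem_cone {θ : EuclideanSpace ℝ (Fin s)} (hθ : θ ∈ cone X) (k : ℕ) :
    (k : ℝ) • θ ∈ cone X := smul_mem_cone hθ (Nat.cast_nonneg k)

/-- The sum of the points chosen for `kθ` and `lθ` lies near `(k + l)θ`. Concatenation then gives
superadditivity up to a polynomial factor, and word lengths linear in `k` give the linear upper
bound. -/
theorem exists_tendsto_growthSeq (hℓ : ∀ j, 0 < ℓ (X j)) {θ : EuclideanSpace ℝ (Fin s)}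
    (hθ : θ ∈ cone X) : ∃ L, Tendsto (growthSeq X θ) atTop (𝓝 L) := by
  obtain ⟨R, hR⟩ := exists_multiplicity_eq X
  choose z hz hzR hzm using fun k : ℕ => hR _ (natCast_smul_mem_cone hθ k)
  have hR0 : 0 ≤ R := dist_nonneg.trans (hzR 0)
  have hpos : ∀ k, 0 < latticeMultiplicity X (z k) := fun k =>
    (latticeMultiplicity_pos hℓ).2 (hz k)
  obtain ⟨C, hC⟩ := exists_latticeMultiplicity_le_near hℓ θ (2 * R)
  obtain ⟨K, hK⟩ := exists_length_le_near hℓ θ R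
  refine exists_tendsto_of_almost_superadditive
    (g := fun k => Real.log (multiplicity X ((k : ℝ) • θ))) (A := C + 2 * C)
    (M := K * Real.log (m + 1)) (by positivity) (fun k => Real.log_natCast_nonneg _)
    (fun k => ?_) fun k l => ?_
  · simp only [hzm]
    have h1 : latticeMultiplicity X (z k) ≤ (m + 1) ^ (K * (k + 1)) :=
      latticeMultiplicity_le_pow fun w hw => hK k w (hw ▸ hzR k)
    have h2 : Real.log (latticeMultiplicity X (z k)) ≤
        Real.log ((m + 1 : ℝ) ^ (K * (k + 1))) :=
      Real.log_le_log (by exact_mod_cast hpos k) (by exact_mod_cast h1)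
    rw [Real.log_pow] at h2
    push_cast at h2
    linarith
  · simp only [hzm]
    have h1 := latticeMultiplicity_mul_le hℓ (z k) (z l)
    have h2 := hC (k + l) (z (k + l)) (hz _) (z k + z l) ((hzR _).trans (by linarith)) (by
      rw [toEuclid_add]
      push_cast
      rw [add_smul]
      refine (dist_add_add_le _ _ _ _).trans ?_
      linarith [hzR k, hzR l])
    have h3 := log_le_log_add_sqrt (mul_pos (hpos k) (hpos l)) (hpos (k + l)) (h1.trans h2)
    push_cast at h3
    rwa [Real.log_mul (by exact_mod_cast (hpos k).ne') (by exact_mod_cast (hpos l).ne')] at h3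

lemma exists_log_multiplicity_le (hX : ∀ j, 0 < ℓ (X j)) (hY : ∀ j, 0 < ℓ (Y j))
    {D : Finset (Fin s → ℤ)}
    (hD : ∀ z, latticeMultiplicity X z ≤ ∑ e ∈ D, latticeMultiplicity Y (z + e))
    {θ : EuclideanSpace ℝ (Fin s)} (hθX : θ ∈ cone X) (hθY : θ ∈ cone Y) :
    ∃ A : ℝ, ∀ k : ℕ, Real.log (multiplicity X ((k : ℝ) • θ)) ≤
      Real.log (multiplicity Y ((k : ℝ) • θ)) + A * √(k + 1) := by
  obtain ⟨R, hR⟩ := exists_multiplicity_eq X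
  obtain ⟨R', hR'⟩ := exists_multiplicity_eq Y
  obtain ⟨C, hC⟩ := exists_latticeMultiplicity_le_near hY θ
    (max R' (R + ∑ e ∈ D, ‖toEuclid e‖))
  refine ⟨(D.card * C : ℕ) + 2 * C, fun k => ?_⟩
  obtain ⟨z, hz, hzR, hzm⟩ := hR _ (natCast_smul_mem_cone hθX k)
  obtain ⟨y, hy, hyR, hym⟩ := hR' _ (natCast_smul_mem_cone hθY k)
  rw [hzm, hym]
  refine log_le_log_add_sqrt ((latticeMultiplicity_pos hX).2 hz)
    ((latticeMultiplicity_pos hY).2 hy) ((hD z).trans ?_)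
  refine (Finset.sum_le_card_nsmul _ _ _ fun e he => hC k y hy (z + e)
    (hyR.trans (le_max_left _ _)) (le_trans ?_ (le_max_right _ _))).trans ?_
  · have h1 : ‖toEuclid e‖ ≤ ∑ e ∈ D, ‖toEuclid e‖ :=
      Finset.single_le_sum (f := fun e => ‖toEuclid e‖) (fun _ _ => norm_nonneg _) he
    rw [toEuclid_add]
    refine (dist_triangle _ (toEuclid z) _).trans ?_
    rw [dist_self_add_right]
    linarith
  · rw [smul_eq_mul, mul_assoc, mul_assoc, mul_assoc]

lemma cone_subset_of_dominated (hX : ∀ j, 0 < ℓ (X j)) (hY : ∀ j, 0 < ℓ (Y j))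
    {D : Finset (Fin s → ℤ)}
    (hD : ∀ z, latticeMultiplicity X z ≤ ∑ e ∈ D, latticeMultiplicity Y (z + e)) :
    cone X ⊆ cone Y := by
  classical
  refine cone_subset_cone fun j => ?_
  have h1 : ∀ k : ℕ, ∃ e : D, ∃ B : Multiset (Fin n), (B.map Y).sum = k • X j + e.1 := by
    intro k
    have h2 : 0 < latticeMultiplicity X (k • X j) := by
      rw [latticeMultiplicity_pos hX]
      exact ⟨Pi.single j k, by simp [Pi.single_apply, ite_smul]⟩
    obtain ⟨e, he, hpos⟩ := Finset.sum_pos_iff.1 (h2.trans_le (hD _))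
    exact ⟨⟨e, he⟩, exists_multiset_of_mem_semigroup ((latticeMultiplicity_pos hY).1 hpos)⟩
  choose e B hB using h1
  -- By pigeonhole one translation `e₀` serves infinitely many `k`. Dickson's lemma finds two of
  -- them with nested representations, and subtracting cancels `e₀`, so a positive multiple of `X j`
  -- lies in the semigroup of `Y`.
  obtain ⟨e₀, he₀⟩ := Finite.exists_infinite_fiber e
  set φ := Nat.orderEmbeddingOfSet (e ⁻¹' {e₀})
  have hφ : ∀ i, e (φ i) = e₀ := fun i =>
    (Nat.orderEmbeddingOfSet_range (e ⁻¹' {e₀})).subset (Set.mem_range_self i)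
  obtain ⟨i, i', hii', hle⟩ := wellQuasiOrdered_le fun i => B (φ i)
  have hlt : φ i < φ i' := φ.strictMono hii'
  obtain ⟨B', hB'⟩ := Multiset.le_iff_exists_add.1 hle
  refine toEuclid_mem_cone_of_nsmul_mem (k := φ i' - φ i) (by omega) ?_
  have h3 := hB (φ i')
  rw [hB', Multiset.map_add, Multiset.sum_add, hB, hφ, hφ] at h3
  have h4 : (φ i' - φ i) • X j = (B'.map Y).sum := by
    have h5 : φ i' • X j = (φ i' - φ i) • X j + φ i • X j := by
      rw [← add_smul, Nat.sub_add_cancel hlt.le]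
    rw [h5] at h3
    have h6 : φ i • X j + e₀.1 + (B'.map Y).sum = φ i • X j + e₀.1 + (φ i' - φ i) • X j := by
      rw [h3]; abel
    exact (add_left_cancel h6).symm
  rw [h4]
  exact multiset_sum_mem_semigroup Y B'

/-- If the multiplicities of two families dominate each other up to finitely many translations,
then the families have the same cone and the same directional growth function. -/
theorem cone_eq_and_directionalGrowth_eq (hX : ∀ j, 0 < ℓ (X j)) (hY : ∀ j, 0 < ℓ (Y j))
    {D D' : Finset (Fin s → ℤ)}
    (hD : ∀ z, latticeMultiplicity X z ≤ ∑ e ∈ D, latticeMultiplicity Y (z + e))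
    (hD' : ∀ z, latticeMultiplicity Y z ≤ ∑ e ∈ D', latticeMultiplicity X (z + e)) :
    cone X = cone Y ∧ ∀ θ ∈ cone X,
      Tendsto (growthSeq X θ) atTop (𝓝 (directionalGrowth X θ)) ∧
      Tendsto (growthSeq Y θ) atTop (𝓝 (directionalGrowth Y θ)) ∧
      directionalGrowth X θ = directionalGrowth Y θ := by
  have hcone : cone X = cone Y :=
    (cone_subset_of_dominated hX hY hD).antisymm (cone_subset_of_dominated hY hX hD')
  refine ⟨hcone, fun θ hθ => ?_⟩
  have hle : ∀ {a b : ℕ} {X : Fin a → Fin s → ℤ} {Y : Fin b → Fin s → ℤ} {L L' A : ℝ},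
      Tendsto (growthSeq X θ) atTop (𝓝 L) → Tendsto (growthSeq Y θ) atTop (𝓝 L') →
      (∀ k : ℕ, Real.log (multiplicity X ((k : ℝ) • θ)) ≤
        Real.log (multiplicity Y ((k : ℝ) • θ)) + A * √(k + 1)) → L ≤ L' := by
    intro a b X Y L L' A hL hL' h
    have h1 := hL'.add (tendsto_sqrt_div_atTop A)
    rw [add_zero] at h1
    refine le_of_tendsto_of_tendsto' hL h1 fun k => ?_
    rw [growthSeq, growthSeq, ← add_div]
    exact div_le_div_of_nonneg_right (h k) (Nat.cast_nonneg k)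
  obtain ⟨L, hL⟩ := exists_tendsto_growthSeq hX hθ
  obtain ⟨L', hL'⟩ := exists_tendsto_growthSeq hY (hcone ▸ hθ)
  obtain ⟨A, hA⟩ := exists_log_multiplicity_le hX hY hD hθ (hcone ▸ hθ)
  obtain ⟨A', hA'⟩ := exists_log_multiplicity_le hY hX hD' (hcone ▸ hθ) hθ
  rw [directionalGrowth, directionalGrowth, hL.limUnder_eq, hL'.limUnder_eq]
  exact ⟨hL, hL', (hle hL hL' hA).antisymm (hle hL' hL hA')⟩

end growth

/-! ### Cylinders of dust-like self-similar sets -/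

section geometry

variable {d m n : ℕ}

/-- The composition `φ_{i₁} ∘ ⋯ ∘ φ_{i_k}` along a word. -/
def wordMap {α : Type*} (φ : Fin m → α → α) : List (Fin m) → α → α
  | [] => id
  | j :: w => φ j ∘ wordMap φ w

lemma wordMap_append_singleton {α : Type*} (φ : Fin m → α → α) (w : List (Fin m)) (j : Fin m) :
    wordMap φ (w ++ [j]) = wordMap φ w ∘ φ j := by
  induction w with
  | nil => rfl
  | cons i w ih => rw [List.cons_append, wordMap, ih, wordMap, Function.comp_assoc]

lemma dist_wordMap {φ : Fin m → EuclideanSpace ℝ (Fin d) → EuclideanSpace ℝ (Fin d)}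
    {ρ : Fin m → ℝ} (hφ : ∀ j, IsSimilarity (ρ j) (φ j)) (w : List (Fin m))
    (x y : EuclideanSpace ℝ (Fin d)) :
    dist (wordMap φ w x) (wordMap φ w y) = wordProd ρ w * dist x y := by
  induction w with
  | nil => simp [wordMap]
  | cons j w ih =>
    rw [wordMap, Function.comp_apply, Function.comp_apply, hφ j, ih, wordProd_cons, mul_assoc]

lemma exists_forall_le_dist_of_pairwise_disjoint {α : Type*} [MetricSpace α] {K : Fin m → Set α}
    (hK : ∀ j, IsCompact (K j)) (hdisj : Pairwise fun i j => Disjoint (K i) (K j)) :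
    ∃ g : ℝ, 0 < g ∧ ∀ i j, i ≠ j → ∀ x ∈ K i, ∀ y ∈ K j, g ≤ dist x y := by
  have h : ∀ᶠ g : ℝ in 𝓝[>] 0, ∀ i j, i ≠ j → ∀ x ∈ K i, ∀ y ∈ K j, g ≤ dist x y := by
    refine eventually_all.2 fun i => eventually_all.2 fun j => ?_
    by_cases hij : i = j
    · exact Eventually.of_forall fun g h => (h hij).elim
    · obtain ⟨r, hr, h⟩ := Metric.exists_pos_forall_lt_edist (hK i) (hK j).isClosed (hdisj hij)
      filter_upwards [Ioc_mem_nhdsGT (show (0 : ℝ) < r by exact_mod_cast hr)] with g hg _ x hx y hy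
      have h1 := (h x hx y hy).le
      rw [edist_nndist, ENNReal.coe_le_coe, ← NNReal.coe_le_coe, coe_nndist] at h1
      exact hg.2.trans h1
  obtain ⟨g, hg, hg0⟩ := (h.and self_mem_nhdsWithin).exists
  exact ⟨g, hg0, hg⟩

lemma exists_isCylinderSystem {ρ : Fin m → ℝ} (hρ : ∀ j, 0 < ρ j ∧ ρ j < 1)
    {E : Set (EuclideanSpace ℝ (Fin d))} (hE : E ∈ dustLike d ρ) :
    ∃ A : List (Fin m) → Set E, IsCylinderSystem ρ A := by
  obtain ⟨φ, hφ, ⟨hne, hcomp, hself⟩, hdisj⟩ := hE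
  have hcont : ∀ j, Continuous (φ j) := fun j =>
    (LipschitzWith.of_dist_le_mul (K := ⟨ρ j, (hρ j).1.le⟩) fun x y => (hφ j x y).le).continuous
  have hsub : ∀ w, wordMap φ w '' E ⊆ E := by
    intro w
    induction w with
    | nil => simp [wordMap]
    | cons j w ih =>
      rw [wordMap, Set.image_comp]
      refine (Set.image_mono ih).trans ?_
      conv_rhs => rw [hself]
      exact Set.subset_iUnion (fun j => φ j '' E) j
  have hpos := fun w => (wordProd_pos (fun j => (hρ j).1) w)
  refine ⟨fun w => {x | x.1 ∈ wordMap φ w '' E}, hρ, ?_, ?_, ?_, ?_, ?_⟩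
  · ext x
    simp [wordMap]
  · intro w
    ext x
    simp only [Set.mem_iUnion, Set.mem_ofPred_eq]
    simp only [wordMap_append_singleton, Set.image_comp]
    rw [← Set.mem_iUnion, ← Set.image_iUnion, ← hself]
  · intro w
    obtain ⟨y, hy⟩ := hne
    exact ⟨⟨_, hsub w ⟨y, hy, rfl⟩⟩, y, hy, rfl⟩
  · refine ⟨Metric.diam E + 1, by positivity, ?_⟩
    rintro w ⟨_, _⟩ ⟨x, hx, rfl⟩ ⟨_, _⟩ ⟨y, hy, rfl⟩
    rw [Subtype.dist_eq, dist_wordMap hφ, mul_comm]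
    refine mul_le_mul_of_nonneg_right ?_ (hpos w).le
    linarith [Metric.dist_le_diam_of_mem hcomp.isBounded hx hy]
  · obtain ⟨g, hg, h⟩ := exists_forall_le_dist_of_pairwise_disjoint
      (fun j => hcomp.image (hcont j)) hdisj
    refine ⟨g, hg, ?_⟩
    rintro w i j hij ⟨_, _⟩ ⟨x, hx, rfl⟩ ⟨_, _⟩ ⟨y, hy, rfl⟩
    rw [Subtype.dist_eq]
    simp only [wordMap_append_singleton, Function.comp_apply]
    rw [dist_wordMap hφ, mul_comm]
    exact mul_le_mul_of_nonneg_left (h i j hij _ ⟨x, hx, rfl⟩ _ ⟨y, hy, rfl⟩) (hpos w).le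

lemma IsCylinderSystem.preimage {E F : Type*} [MetricSpace E] [MetricSpace F] {τ : Fin n → ℝ}
    {B : List (Fin n) → Set F} (hB : IsCylinderSystem τ B) {f : E → F}
    (hf : Function.Bijective f) {C : ℝ} (hC : 0 < C)
    (h : ∀ x y, C⁻¹ * dist x y ≤ dist (f x) (f y) ∧ dist (f x) (f y) ≤ C * dist x y) :
    IsCylinderSystem τ fun v => f ⁻¹' B v where
  ratio := hB.ratio
  nil := by rw [hB.nil, Set.preimage_univ]
  split w := by rw [hB.split, Set.preimage_iUnion]
  nonempty w := (hB.nonempty w).preimage hf.surjective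
  exists_dist_le := by
    obtain ⟨D, hD, h'⟩ := hB.exists_dist_le
    refine ⟨C * D, mul_pos hC hD, fun w x hx y hy => ?_⟩
    have h1 := (h x y).1.trans (h' w _ hx _ hy)
    rwa [inv_mul_le_iff₀ hC, ← mul_assoc] at h1
  exists_le_dist := by
    obtain ⟨g, hg, h'⟩ := hB.exists_le_dist
    refine ⟨C⁻¹ * g, by positivity, fun w i j hij x hx y hy => ?_⟩
    have h1 := (h' w i j hij _ hx _ hy).trans (h x y).2
    rwa [mul_assoc, inv_mul_le_iff₀ hC]

lemma exists_isCylinderSystem_pair {ρ : Fin m → ℝ} {τ : Fin n → ℝ}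
    (hρ : IsContractionVector d ρ) (hτ : IsContractionVector d τ)
    (h : DustLikeEquivalent d ρ τ) :
    ∃ (E : Set (EuclideanSpace ℝ (Fin d))) (A : List (Fin m) → Set E)
      (B : List (Fin n) → Set E), IsCylinderSystem ρ A ∧ IsCylinderSystem τ B := by
  obtain ⟨E, hE, F, hF, f, hf, C, hC, hfC⟩ := h
  obtain ⟨A, hA⟩ := exists_isCylinderSystem hρ.1 hE
  obtain ⟨B, hB⟩ := exists_isCylinderSystem hτ.1 hF
  exact ⟨E, A, _, hA, hB.preimage hf hC hfC⟩

/-- The sum is `n > 1` at exponent `0` and less than `1` at exponent `d`. -/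
lemma exists_sum_rpow_eq_one [Nontrivial (Fin n)] {τ : Fin n → ℝ}
    (hτ : IsContractionVector d τ) : ∃ δ : ℝ, 0 < δ ∧ ∑ j, τ j ^ δ = 1 := by
  have hcont : Continuous fun δ : ℝ => ∑ j, τ j ^ δ :=
    continuous_finsetSum _ fun j _ =>
      continuous_const.rpow continuous_id fun _ => Or.inl (hτ.1 j).1.ne'
  have hn : 1 < n := Fin.nontrivial_iff_two_le.1 inferInstance
  have hn' : (1 : ℝ) < n := by exact_mod_cast hn
  obtain ⟨δ, ⟨hδ, -⟩, hsum⟩ := intermediate_value_Icc' (Nat.cast_nonneg (α := ℝ) d)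
    hcont.continuousOn (show (1 : ℝ) ∈ Set.Icc _ _ from
      ⟨by simpa [Real.rpow_natCast] using hτ.2.le, by simpa using hn'.le⟩)
  refine ⟨δ, hδ.lt_of_ne ?_, hsum⟩
  rintro rfl
  simp at hsum
  omega

end geometry

/-! ### Transfer to the lattice -/

section transfer

variable {d m n s : ℕ} {ρ : Fin m → ℝ} {τ : Fin n → ℝ} {lam : Fin s → ℝ}
  {X : Fin m → Fin s → ℤ} {Y : Fin n → Fin s → ℤ}

lemma expBasis_add (hlam : ∀ i, 0 < lam i) (x y : Fin s → ℤ) :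
    expBasis lam (x + y) = expBasis lam x * expBasis lam y := by
  simp only [expBasis, Pi.add_apply, ← Finset.prod_mul_distrib]
  exact Finset.prod_congr rfl fun i _ => zpow_add₀ (hlam i).ne' _ _

lemma expBasis_pos (hlam : ∀ i, 0 < lam i) (x : Fin s → ℤ) : 0 < expBasis lam x :=
  Finset.prod_pos fun i _ => zpow_pos (hlam i) _

lemma expBasis_position (hlam : ∀ i, 0 < lam i) (hX : ∀ j, expBasis lam (X j) = ρ j)
    (w : List (Fin m)) : expBasis lam (position X w) = wordProd ρ w := by
  induction w with
  | nil => simp [expBasis]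
  | cons j w ih => rw [position_cons, expBasis_add hlam, ih, hX, wordProd_cons]

/-- The additive functional `x ↦ -log λ^x`. -/
noncomputable def negLogHom (hlam : ∀ i, 0 < lam i) : (Fin s → ℤ) →+ ℝ where
  toFun x := -Real.log (expBasis lam x)
  map_zero' := by simp [expBasis]
  map_add' x y := by
    rw [expBasis_add hlam, Real.log_mul (expBasis_pos hlam x).ne' (expBasis_pos hlam y).ne']
    ring

lemma negLogHom_pos (hlam : ∀ i, 0 < lam i) (hX : ∀ j, expBasis lam (X j) = ρ j)
    (hρ : ∀ j, 0 < ρ j ∧ ρ j < 1) (j : Fin m) : 0 < negLogHom hlam (X j) := by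
  show 0 < -Real.log (expBasis lam (X j))
  rw [hX, neg_pos]
  exact Real.log_neg (hρ j).1 (hρ j).2

theorem exists_dominated {E : Type*} [MetricSpace E] [Nontrivial (Fin m)]
    (hlam : ∀ i, 0 < lam i) (hinj : Function.Injective (expBasis lam))
    (hX : ∀ j, expBasis lam (X j) = ρ j) (hY : ∀ j, expBasis lam (Y j) = τ j)
    {A : List (Fin m) → Set E} {B : List (Fin n) → Set E} (hA : IsCylinderSystem ρ A)
    (hB : IsCylinderSystem τ B) {δ : ℝ} (hδ : 0 < δ) (hτ : ∑ j, τ j ^ δ = 1) :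
    ∃ D : Finset (Fin s → ℤ),
      ∀ z, latticeMultiplicity X z ≤ ∑ e ∈ D, latticeMultiplicity Y (z + e) := by
  have hℓX := negLogHom_pos hlam hX hA.ratio
  have hℓY := negLogHom_pos hlam hY hB.ratio
  obtain ⟨D, hD, h⟩ := exists_rigid_coding hA hB hδ hτ
  -- Injectivity of the exponential turns finitely many ratio factors into finitely many lattice
  -- translations.
  have hD' : (expBasis lam ⁻¹' D).Finite := hD.preimage hinj.injOn
  refine ⟨hD'.toFinset, fun z => ?_⟩
  obtain ⟨L, hL⟩ := exists_length_le hℓX z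
  obtain ⟨V, hV, hVinj⟩ := h L
  refine le_trans ?_ (Finset.set_ncard_biUnion_le hD'.toFinset
    fun e => {v | position Y v = z + e})
  refine Set.ncard_le_ncard_of_injOn V (fun u hu => ?_) (fun u hu u' hu' heq => ?_)
    (hD'.toFinset.finite_toSet.biUnion fun e _ => finite_position_eq hℓY _)
  · have hu' : position X u = z := hu
    refine Set.mem_biUnion (x := position Y (V u) - z) ?_ ?_
    · rw [Finset.mem_coe, Set.Finite.mem_toFinset, Set.mem_preimage]
      have h1 := hV u (hL u hu)
      rw [← expBasis_position hlam hX, ← expBasis_position hlam hY, hu'] at h1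
      convert h1 using 1
      rw [eq_div_iff (expBasis_pos hlam z).ne', ← expBasis_add hlam, sub_add_cancel]
    · show position Y (V u) = z + (position Y (V u) - z)
      abel
  · have hpos : position X u = position X u' := Eq.trans hu (Eq.symm hu')
    rcases hVinj u u' (hL u hu) (hL u' hu') heq with h1 | h1
    · exact eq_of_prefix_of_position_eq hℓX h1 hpos
    · exact (eq_of_prefix_of_position_eq hℓX h1 hpos.symm).symm

end transfer

/-! ### The case of a single contraction -/

section singleton

variable {m n s : ℕ}

lemma IsCylinderSystem.nonempty_fin {E : Type*} [MetricSpace E] {ρ : Fin m → ℝ}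
    {A : List (Fin m) → Set E} (hA : IsCylinderSystem ρ A) : Nonempty (Fin m) := by
  obtain ⟨x, hx⟩ := hA.nonempty []
  rw [hA.split, Set.mem_iUnion] at hx
  exact hx.nonempty

lemma IsCylinderSystem.nontrivial_iff {E : Type*} [MetricSpace E] {ρ : Fin m → ℝ}
    {A : List (Fin m) → Set E} (hA : IsCylinderSystem ρ A) :
    Nontrivial E ↔ Nontrivial (Fin m) := by
  constructor
  · rintro ⟨x, y, hxy⟩
    by_contra hm
    rw [not_nontrivial_iff_subsingleton] at hm
    obtain ⟨D, hD, h⟩ := hA.exists_dist_le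
    obtain ⟨N, hN⟩ := exists_wordProd_lt hA.ratio (div_pos (dist_pos.2 hxy) hD)
    obtain ⟨u, hu, hxu⟩ := hA.exists_mem_append (w := []) (x := x) (by simp [hA.nil]) N
    obtain ⟨v, hv, hyv⟩ := hA.exists_mem_append (w := []) (x := y) (by simp [hA.nil]) N
    have huv : u = v := List.ext_getElem (hu.trans hv.symm) fun _ _ _ => Subsingleton.elim _ _
    subst huv
    have h1 := h _ x hxu y hyv
    have h2 := hN u hu.ge
    rw [lt_div_iff₀ hD] at h2
    rw [List.nil_append] at h1
    linarith
  · intro hm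
    obtain ⟨g, hg, h⟩ := hA.exists_mem_le_dist
    obtain ⟨x, -, y, -, hxy⟩ := h []
    refine ⟨x, y, dist_pos.1 (lt_of_lt_of_le ?_ hxy)⟩
    simpa using hg

lemma mulRank_le_one [Subsingleton (Fin m)] {ρ : Fin m → ℝ} (hρ : ∀ j, 0 < ρ j) (j : Fin m) :
    mulRank ρ ≤ 1 := by
  have hset : {u : ℝˣ | ∃ j, (u : ℝ) = ρ j} = {Units.mk0 (ρ j) (hρ j).ne'} := by
    ext u
    constructor
    · rintro ⟨i, hi⟩
      rw [Subsingleton.elim i j] at hi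
      exact Units.ext hi
    · rintro rfl
      exact ⟨j, rfl⟩
  refine finrank_le_one (Additive.ofMul (⟨Units.mk0 (ρ j) (hρ j).ne',
    Subgroup.subset_closure ⟨j, rfl⟩⟩ : mulGroup ρ)) fun g => ?_
  have hgen : ∀ u ∈ mulGroup ρ, ∃ k : ℤ, Units.mk0 (ρ j) (hρ j).ne' ^ k = u := fun u hu => by
    rwa [mulGroup, hset, Subgroup.mem_closure_singleton] at hu
  obtain ⟨k, hk⟩ := hgen _ g.toMul.2
  exact ⟨k, Additive.toMul.injective (Subtype.ext hk)⟩

/-- Over a one-letter alphabet multiplicities are at most `1`, so it suffices to find, at bounded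
distance from `z` in `ℤ`, a multiple of one `Y k`. -/
lemma exists_dominated_of_subsingleton [Subsingleton (Fin m)] (hs : s ≤ 1)
    {X : Fin m → Fin s → ℤ} {Y : Fin n → Fin s → ℤ} {ℓ : (Fin s → ℤ) →+ ℝ}
    (hX : ∀ j, 0 < ℓ (X j)) (hY : ∀ j, 0 < ℓ (Y j)) (k : Fin n) :
    ∃ D : Finset (Fin s → ℤ),
      ∀ z, latticeMultiplicity X z ≤ ∑ e ∈ D, latticeMultiplicity Y (z + e) := by
  obtain rfl : s = 1 := by
    rcases hs.lt_or_eq with h | h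
    · obtain rfl : s = 0 := by omega
      have := hY k
      rw [Subsingleton.elim (Y k) 0, map_zero] at this
      exact (lt_irrefl _ this).elim
    · exact h
  have hfin : {e : Fin 1 → ℤ | |ℓ e| ≤ ℓ (Y k)}.Finite := by
    have hℓe : ∀ e : Fin 1 → ℤ, ℓ e = e 0 * ℓ (Pi.single 0 1) := by
      intro e
      have he : e = e 0 • Pi.single 0 1 := by
        ext i
        simp [Subsingleton.elim i 0]
      conv_lhs => rw [he, map_zsmul, zsmul_eq_mul]
    have h0 : ℓ (Pi.single 0 1) ≠ 0 := by
      intro h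
      have := hY k
      rw [hℓe, h, mul_zero] at this
      exact lt_irrefl _ this
    refine (Set.finite_Icc (fun _ : Fin 1 => -⌈ℓ (Y k) / |ℓ (Pi.single 0 1)|⌉)
      (fun _ => ⌈ℓ (Y k) / |ℓ (Pi.single 0 1)|⌉)).subset fun e he => ?_
    have h1 : |ℓ e| ≤ ℓ (Y k) := he
    rw [hℓe, abs_mul, ← le_div_iff₀ (abs_pos.2 h0)] at h1
    have h2 := abs_le.1 (h1.trans (Int.le_ceil _))
    refine ⟨fun i => ?_, fun i => ?_⟩ <;> rw [Subsingleton.elim i 0]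
    · exact_mod_cast h2.1
    · exact_mod_cast h2.2
  refine ⟨hfin.toFinset, fun z => ?_⟩
  have hle : latticeMultiplicity X z ≤ 1 := by
    refine (Set.ncard_le_one (finite_position_eq hX z)).2 fun u hu v hv => ?_
    have huv : position X u = position X v := Eq.trans hu (Eq.symm hv)
    have h1 : ∀ (u v : List (Fin m)), u <+: v ∨ v <+: u := by
      intro u v
      rw [List.prefix_iff_eq_take, List.prefix_iff_eq_take]
      rcases le_total u.length v.length with h | h
      · exact Or.inl (List.ext_getElem (by simpa using h) fun _ _ _ => Subsingleton.elim _ _)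
      · exact Or.inr (List.ext_getElem (by simpa using h) fun _ _ _ => Subsingleton.elim _ _)
    rcases h1 u v with h | h
    · exact eq_of_prefix_of_position_eq hX h huv
    · exact (eq_of_prefix_of_position_eq hX h huv.symm).symm
  rcases Nat.eq_zero_or_pos (latticeMultiplicity X z) with h0 | hpos
  · rw [h0]
    exact Nat.zero_le _
  -- The multiple of `Y k` is obtained by rounding down `ℓ z / ℓ (Y k)`; the error in `ℓ` is at most
  -- `ℓ (Y k)`.
  refine hle.trans (Nat.succ_le_of_lt (Finset.sum_pos_iff.2 ⟨⌊ℓ z / ℓ (Y k)⌋₊ • Y k - z, ?_, ?_⟩))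
  · rw [Set.Finite.mem_toFinset]
    show |ℓ (_ - z)| ≤ ℓ (Y k)
    have hz : 0 ≤ ℓ z := by
      obtain ⟨w, rfl⟩ := exists_position_iff.2 ((latticeMultiplicity_pos hX).1 hpos)
      obtain ⟨c, hc, h⟩ := exists_mul_length_le hX
      exact (by positivity : 0 ≤ c * w.length).trans (h w)
    have h1 := Nat.floor_le (div_nonneg hz (hY k).le)
    have h2 := Nat.lt_floor_add_one (ℓ z / ℓ (Y k))
    rw [le_div_iff₀ (hY k)] at h1
    rw [div_lt_iff₀ (hY k)] at h2
    rw [map_sub, map_nsmul, nsmul_eq_mul, abs_le]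
    constructor <;> linarith [hY k]
  · rw [add_sub_cancel, latticeMultiplicity_pos hY]
    exact ⟨Pi.single k ⌊ℓ z / ℓ (Y k)⌋₊, by simp [Pi.single_apply, ite_smul]⟩

end singleton

end FrobeniusLipschitz

/-! ### The main theorem -/

open FrobeniusLipschitz

theorem mainTheorem1 {d m n s : ℕ} (ρ : Fin m → ℝ) (τ : Fin n → ℝ) (lam : Fin s → ℝ)
    (hρ : IsContractionVector d ρ) (hτ : IsContractionVector d τ)
    (hequiv : DustLikeEquivalent d ρ τ)
    (hlamρ : IsPseudoBasis ρ lam) (hlamτ : IsPseudoBasis τ lam)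
    (X : Fin m → Fin s → ℤ) (hX : ∀ j, X j = logBasis lam (ρ j))
    (Y : Fin n → Fin s → ℤ) (hY : ∀ k, Y k = logBasis lam (τ k)) :
    cone X = cone Y ∧
      ∀ θ ∈ cone X, ‖θ‖ = 1 →
        Tendsto (growthSeq X θ) atTop (𝓝 (directionalGrowth X θ)) ∧
        Tendsto (growthSeq Y θ) atTop (𝓝 (directionalGrowth Y θ)) ∧
        directionalGrowth X θ = directionalGrowth Y θ := by
  have hX' : ∀ j, expBasis lam (X j) = ρ j := fun j =>
    (logBasis_eq_iff hlamρ (fun j => (hρ.1 j).1) j (X j)).1 (hX j).symm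
  have hY' : ∀ k, expBasis lam (Y k) = τ k := fun k =>
    (logBasis_eq_iff hlamτ (fun k => (hτ.1 k).1) k (Y k)).1 (hY k).symm
  have hinj := expBasis_injective hlamρ
  have hℓX := negLogHom_pos hlamρ.1 hX' hρ.1
  have hℓY := negLogHom_pos hlamρ.1 hY' hτ.1
  obtain ⟨E, A, B, hA, hB⟩ := exists_isCylinderSystem_pair hρ hτ hequiv
  obtain ⟨D, D', hD, hD'⟩ : ∃ D D' : Finset (Fin s → ℤ),
      (∀ z, latticeMultiplicity X z ≤ ∑ e ∈ D, latticeMultiplicity Y (z + e)) ∧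
      ∀ z, latticeMultiplicity Y z ≤ ∑ e ∈ D', latticeMultiplicity X (z + e) := by
    -- Both alphabets have at least two letters exactly when the common space has two points.
    -- Otherwise both have one letter and the rank condition gives `s ≤ 1`.
    by_cases hE : Nontrivial E
    · have := hA.nontrivial_iff.1 hE
      have := hB.nontrivial_iff.1 hE
      obtain ⟨δ, hδ, hδτ⟩ := exists_sum_rpow_eq_one hτ
      obtain ⟨δ', hδ', hδρ⟩ := exists_sum_rpow_eq_one hρ
      obtain ⟨D, hD⟩ := exists_dominated hlamρ.1 hinj hX' hY' hA hB hδ hδτ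
      obtain ⟨D', hD'⟩ := exists_dominated hlamρ.1 hinj hY' hX' hB hA hδ' hδρ
      exact ⟨D, D', hD, hD'⟩
    · have := not_nontrivial_iff_subsingleton.1 fun h => hE (hA.nontrivial_iff.2 h)
      have := not_nontrivial_iff_subsingleton.1 fun h => hE (hB.nontrivial_iff.2 h)
      obtain ⟨j⟩ := hA.nonempty_fin
      obtain ⟨k⟩ := hB.nonempty_fin
      have hs : s ≤ 1 := hlamρ.2.2 ▸ mulRank_le_one (fun j => (hρ.1 j).1) j
      obtain ⟨D, hD⟩ := exists_dominated_of_subsingleton hs hℓX hℓY k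
      obtain ⟨D', hD'⟩ := exists_dominated_of_subsingleton hs hℓY hℓX j
      exact ⟨D, D', hD, hD'⟩
  obtain ⟨hcone, h⟩ := cone_eq_and_directionalGrowth_eq hℓX hℓY hD hD'
  exact ⟨hcone, fun θ hθ _ => h θ hθ⟩
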